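/- **Setting.** Let $N\ge 2$, $d\ge 0$ be integers. Let $\boldsymbol A=(a_{ij})\in\mathbb R^{N\times N}$ be symmetric with $\boldsymbol 1^\top \boldsymbol A=\boldsymbol 1^\top$, $\boldsymbol A\boldsymbol 1=\boldsymbol 1$ and $\|\boldsymbol A-\boldsymbol 1\boldsymbol 1^\top/N\|\le s<1$ (spectral norm), and let $\sigma_2$ be its second largest eigenvalue. Let $f_1,\dots,f_N:\mathbb R^d\to\mathbb R$ be twice differentiable, with $\nabla f_i$ $L_i$-Lipschitz, $\nabla^2 f_i$ $\rho_i$-Lipschitz (operator norm), and $\|\nabla f_i(\theta)\|\le G$ for all $\theta\in\mathbb R^d$ and all $i$, where $G>0$. Put $\rho=\frac1N\sum_i\rho_i$ and assume $\rho>0$. Let $\boldsymbol x^0=(\boldsymbol x^0_1,\dots,\boldsymbol x^0_N)\in(\mathbb R^d)^N$, let $f_0=\frac1N\sum_i f_i(\boldsymbol x_i^0)$, and let $f^\star\in\mathbb R$ satisfy $f^\star\le \frac1N\sum_i f_i(\theta)$ for all $\theta$ and $f^\star\le f_0$. **Stepsizes.** Let $0.6<\alpha<\frac23$, $\frac32\alpha<\beta<1$,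 $c_1,c_2,\ell,\epsilon,\gamma>0$ and $0<p<1$. Put $r_b(t)=\frac{c_1}{1+c_2t^b}$, $\varepsilon_0=r_\alpha(0)=c_1$, $D=\frac{1+(1-\sigma_2)\varepsilon_0}{1-\sigma_2}G^2+(1+(1-\sigma_2)\varepsilon_0)\sigma_2^2Nd\ell^2$, $Q=\frac1{60^2}\sqrt{\epsilon^3/\rho}$, and $$C_1=\Big(\tfrac{4c_1^{2/3}D}{p\,c_2^{2/3}(1-\sigma_2)}\Big)^{\frac3{2\alpha}},\quad C_2=\Big(\tfrac{4(f_0-f^\star)D^{2/3}(1-\sigma_2)^{2/3}c_1}{c_2\,p\,\epsilon^2\sqrt{\rho\epsilon}}\Big)^{\frac1{2\alpha-\beta}},\quad C_3=\Big(\tfrac{12\rho D^{1/6}}{(1-\sigma_2)^{1/6}\sqrt\gamma(\rho\epsilon)^{1/4}\ell}\Big)^{\frac1{\beta-4\alpha/3}}.$$ Choose an integer $t_0\ge\max\{C_1,C_2,C_3\}$ and let $t_{i+1}=t_i+\big\lceil\frac{1+c_2t_i^\alpha}{c_1\sqrt{\rho\epsilon}}\big\rceil$ and $I=\Big\lceil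 30\max\big\{\frac{f_0-f^\star}{Q},\frac{2(f_0-f^\star)r_\alpha(t_0)}{\epsilon^2r_\beta(t_0)}\big\}\Big\rceil$. The stepsizes are $\varepsilon_k=r_\alpha(k)$, $\eta_k=r_\beta(k)$ if $k<t_0$ or $k\ge t_I$, and $\varepsilon_k=r_\alpha(t_i)$, $\eta_k=r_\beta(t_i)$ if $t_i\le k<t_{i+1}$, $0\le i<I$. **Algorithm.** For $k=0,1,2,\dots$ and every agent $i$, $$\boldsymbol x_i^{k+1}=\boldsymbol x_i^k+\varepsilon_k\sum_{j=1}^N a_{ij}\big(Q_\ell(\boldsymbol x_j^k)-\boldsymbol x_i^k\big)-\eta_k\nabla f_i(\boldsymbol x_i^k),$$ where, conditionally on the past up to the determination of $\boldsymbol x^k$, each coordinate $v$ of each $\boldsymbol x_j^k$ is randomly rounded as follows (no independence between different coordinates is required). For even $k$, with $n\in\mathbb Z$, $n\ell\le v<(n+1)\ell$: to $(n+1)\ell$ with probability $\frac v\ell-n$, and otherwise to $n\ell$. For odd $k$, with $n\in\mathbb Z$, $(n-\frac12)\ell\le v<(n+\frac12)\ell$: to $(n+\frac12)\ell$ with probability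 $\frac v\ell-n+\frac12$, and otherwise to $(n-\frac12)\ell$. Let $\bar{\boldsymbol x}^k=\frac1N\sum_i\boldsymbol x_i^k$ and $\|\boldsymbol e^k\|=\big(\sum_i\|\boldsymbol x_i^k-\bar{\boldsymbol x}^k\|^2\big)^{1/2}$ (the consensus error). **Theorem (Consensus of Optimization Variables).** For all $N,d,\alpha,\beta,c_1,c_2,\ell,\epsilon,\rho,G,s$ as above and every $R\in\mathbb R$ there is a constant $C>0$, depending only on these numbers, such that for all $\boldsymbol A$, $f_i$, $L_i$, $\rho_i$, $f^\star$, $\gamma$ as above, all $\boldsymbol x^0$ with $\|\boldsymbol e^0\|\le R$, every $p\in(0,1)$, every admissible $t_0$, and every run of the algorithm on any probability space, $$\mathbb P\Big(\|\boldsymbol e^k\|^2\le C\,\big(\tfrac1k\big)^{\alpha/3}\ \text{ for all } k\ge t_0\Big)\ \ge\ 1-p .$$ Moreover, $\|\boldsymbol e^k\|\to0$ as $k\to\infty$ almost surely. -/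

import Mathlib

open MeasureTheory ProbabilityTheory Filter Topology

noncomputable section

/-- The matrix `𝟏𝟏ᵀ / N`. -/
def averagingMatrix (N : ℕ) : Matrix (Fin N) (Fin N) ℝ :=
  Matrix.of fun _ _ => (1 : ℝ) / N

/-- The spectral norm `‖A - 𝟏𝟏ᵀ / N‖`. -/
def mixingNorm {N : ℕ} (A : Matrix (Fin N) (Fin N) ℝ) : ℝ :=
  ‖Matrix.toEuclideanCLM (n := Fin N) (𝕜 := ℝ) (A - averagingMatrix N)‖

/-- The weight matrix is symmetric and doubly stochastic (up to signs), and
`‖A - 𝟏𝟏ᵀ / N‖ ≤ s`; it is used with `s < 1`. -/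
structure IsWeightMatrix {N : ℕ} (A : Matrix (Fin N) (Fin N) ℝ) (s : ℝ) : Prop where
  symm : A.IsSymm
  one_vecMul : Matrix.vecMul 1 A = 1
  mulVec_one : Matrix.mulVec A 1 = 1
  mixing : mixingNorm A ≤ s

theorem isHermitian_of_isSymm {N : ℕ} {A : Matrix (Fin N) (Fin N) ℝ} (hA : A.IsSymm) :
    A.IsHermitian := by
  rw [Matrix.IsHermitian, Matrix.conjTranspose_eq_transpose_of_trivial]
  exact hA

/-- The second largest eigenvalue of a symmetric matrix, eigenvalues being listed in decreasing
order and repeated according to multiplicity. -/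
def secondEigenvalue {N : ℕ} (A : Matrix (Fin N) (Fin N) ℝ) (hA : A.IsSymm) (hN : 2 ≤ N) : ℝ :=
  (isHermitian_of_isSymm hA).eigenvalues₀ ⟨1, by rw [Fintype.card_fin]; exact hN⟩

/-- `f` is twice differentiable, with `L`-Lipschitz gradient and `r`-Lipschitz Hessian
(the Hessian being the derivative of the gradient, with the operator norm). -/
structure IsSmoothObjective {d : ℕ} (f : EuclideanSpace ℝ (Fin d) → ℝ) (L r : ℝ) : Prop where
  differentiable : Differentiable ℝ f
  differentiable_gradient : Differentiable ℝ (gradient f)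
  gradient_lipschitz : ∀ x y, ‖gradient f x - gradient f y‖ ≤ L * ‖x - y‖
  hessian_lipschitz : ∀ x y,
    ‖fderiv ℝ (gradient f) x - fderiv ℝ (gradient f) y‖ ≤ r * ‖x - y‖

/-- `f(x) = (1/N) ∑ᵢ fᵢ(xᵢ)` for `x = (x₁, …, x_N)`. -/
def globalObjective {N d : ℕ} (f : Fin N → EuclideanSpace ℝ (Fin d) → ℝ)
    (x : Fin N → EuclideanSpace ℝ (Fin d)) : ℝ :=
  (1 / (N : ℝ)) * ∑ i, f i (x i)

/-- The average `x̄` of the agents' variables. -/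
def average {N d : ℕ} (x : Fin N → EuclideanSpace ℝ (Fin d)) : EuclideanSpace ℝ (Fin d) :=
  (1 / (N : ℝ)) • ∑ i, x i

/-- The Frobenius norm `‖e‖` of the matrix `e` with rows `xᵢ - x̄`. -/
def consensusError {N d : ℕ} (x : Fin N → EuclideanSpace ℝ (Fin d)) : ℝ :=
  √(∑ i, ‖x i - average x‖ ^ 2)

/-! ### Quantization -/

/-- The lower quantization point of `v` at iteration `k`: `nℓ` with `nℓ ≤ v < (n+1)ℓ` if `k` is
even, `(n-1/2)ℓ` with `(n-1/2)ℓ ≤ v < (n+1/2)ℓ` if `k` is odd. The upper point is the lower one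
plus `ℓ`. -/
def quantLower (ℓ : ℝ) (k : ℕ) (v : ℝ) : ℝ :=
  if Even k then (⌊v / ℓ⌋ : ℝ) * ℓ else ((⌊v / ℓ + 1 / 2⌋ : ℝ) - 1 / 2) * ℓ

/-- The probability with which `v` is rounded up at iteration `k`: `v/ℓ - n` if `k` is even,
`v/ℓ - n + 1/2` if `k` is odd, with `n` as in `quantLower`. -/
def quantProb (ℓ : ℝ) (k : ℕ) (v : ℝ) : ℝ :=
  if Even k then v / ℓ - ⌊v / ℓ⌋ else v / ℓ - ⌊v / ℓ + 1 / 2⌋ + 1 / 2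

/-! ### Stepsizes -/

/-- The reference function `c₁ / (1 + c₂ t ^ b)`. -/
def refStep (c₁ c₂ b t : ℝ) : ℝ := c₁ / (1 + c₂ * t ^ b)

/-- The times `t₀`, `tᵢ₊₁ = tᵢ + ⌈(1 + c₂ tᵢ ^ α) / (c₁ √(ρ ε))⌉`. -/
def holdTime (c₁ c₂ α ρ ε : ℝ) (t₀ : ℕ) : ℕ → ℕ
  | 0 => t₀
  | i + 1 => holdTime c₁ c₂ α ρ ε t₀ i +
      ⌈(1 + c₂ * (holdTime c₁ c₂ α ρ ε t₀ i : ℝ) ^ α) / (c₁ * √(ρ * ε))⌉₊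

/-- The time at which the reference function is evaluated at iteration `k`, for times
`t 0 < t 1 < … < t I`: it is `k` if `k < t 0` or `k ≥ t I`, and `t i` if `t i ≤ k < t (i+1)` with
`i < I`. -/
def heldTime (t : ℕ → ℕ) (I k : ℕ) : ℕ :=
  if k < t 0 ∨ t I ≤ k then k else t (Nat.findGreatest (fun i => t i ≤ k) I)

/-- The decrease-and-hold stepsize `c₁ / (1 + c₂ · ^ b)` with holding times `t 0, …, t I`. -/
def stepsize (c₁ c₂ b : ℝ) (t : ℕ → ℕ) (I k : ℕ) : ℝ :=
  refStep c₁ c₂ b (heldTime t I k)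

/-- `d₁ + d₂` with `d₁ = (1 + (1-σ) ε₀) / (1-σ) · G²` and
`d₂ = (1 + (1-σ) ε₀) σ² N d ℓ²`, where `ε₀` is the stepsize at time `0`. -/
def noiseConst (N d : ℕ) (ε₀ σ G ℓ : ℝ) : ℝ :=
  (1 + (1 - σ) * ε₀) / (1 - σ) * G ^ 2 + (1 + (1 - σ) * ε₀) * σ ^ 2 * N * d * ℓ ^ 2

/-- The bound `C₁`, with `D = d₁ + d₂`. -/
def threshold₁ (α c₁ c₂ p σ D : ℝ) : ℝ :=
  (4 * c₁ ^ (2 / 3 : ℝ) * D / (p * c₂ ^ (2 / 3 : ℝ) * (1 - σ))) ^ (3 / (2 * α))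

/-- The bound `C₂`, with `D = d₁ + d₂` and `Δ = f₀ - f⋆`. -/
def threshold₂ (α β c₁ c₂ p ρ ε σ D Δ : ℝ) : ℝ :=
  (4 * Δ * D ^ (2 / 3 : ℝ) * (1 - σ) ^ (2 / 3 : ℝ) * c₁ / (c₂ * p * ε ^ 2 * √(ρ * ε)))
    ^ (1 / (2 * α - β))

/-- The bound `C₃`, with `D = d₁ + d₂`. -/
def threshold₃ (α β ρ ε γ ℓ σ D : ℝ) : ℝ :=
  (12 * ρ * D ^ (1 / 6 : ℝ) /
    ((1 - σ) ^ (1 / 6 : ℝ) * √γ * (ρ * ε) ^ (1 / 4 : ℝ) * ℓ)) ^ (1 / (β - 4 * α / 3))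

/-- The number `I` of holding stages, `30 max {Δ / Q, 2 Δ ε_{t₀} / (ε² η_{t₀})}` rounded up,
with `Q = √(ε³ / ρ) / 60²` and `Δ = f₀ - f⋆`. -/
def numHold (α β c₁ c₂ ρ ε Δ : ℝ) (t₀ : ℕ) : ℕ :=
  ⌈30 * max (Δ / (1 / 60 ^ 2 * √(ε ^ 3 / ρ)))
    (2 * Δ * refStep c₁ c₂ α t₀ / (ε ^ 2 * refStep c₁ c₂ β t₀))⌉₊

/-! ### The algorithm -/

/-- `x` is a run of the algorithm with stepsizes `ε`, `η`, quantization level `ℓ` and initial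
value `x₀`, where `q k i` is the quantized value of `x k i`. Given the past `ℱ k`, every
coordinate of `x k` is rounded to its upper or lower quantization point at iteration `k` with the
prescribed probabilities; nothing is assumed on the joint law of the coordinates. -/
structure IsRun {N d : ℕ} {Ω : Type*} {mΩ : MeasurableSpace Ω} (μ : Measure Ω)
    (ℱ : Filtration ℕ mΩ) (A : Matrix (Fin N) (Fin N) ℝ)
    (f : Fin N → EuclideanSpace ℝ (Fin d) → ℝ) (ℓ : ℝ) (ε η : ℕ → ℝ)
    (x₀ : Fin N → EuclideanSpace ℝ (Fin d))
    (x q : ℕ → Ω → Fin N → EuclideanSpace ℝ (Fin d)) : Prop where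
  start : ∀ ω, x 0 ω = x₀
  update : ∀ k ω i, x (k + 1) ω i =
    x k ω i + ε k • (∑ j, A i j • (q k ω j - x k ω i)) - η k • gradient (f i) (x k ω i)
  adapted : ∀ k i c, Measurable[ℱ (k + 1)] fun ω => q k ω i c
  prob_upper : ∀ k i c,
    μ⟦{ω | q k ω i c = quantLower ℓ k (x k ω i c) + ℓ} | ℱ k⟧ =ᵐ[μ]
      fun ω => quantProb ℓ k (x k ω i c)
  prob_lower : ∀ k i c,
    μ⟦{ω | q k ω i c = quantLower ℓ k (x k ω i c)} | ℱ k⟧ =ᵐ[μ]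
      fun ω => 1 - quantProb ℓ k (x k ω i c)

end

/-! The deviation `e` of the agents' variables from their average obeys
`e' = ((1 - ε) e + ε B e - η dev(∇f)) + ε B w` with `B = A - 𝟏𝟏ᵀ / N` and `w` the quantization
noise (`IsWeightMatrix.deviation_update`). As `‖B‖ ≤ s < 1`, the averaging contracts by
`1 - (1 - s) ε` once `ε ≤ 1`; the gradient term is `O(ε ^ (3/2))` because `η² ≲ ε³`; and the noise
is almost surely bounded and conditionally centred given the past (`unbiased_rounding`).

Consequently `E‖e‖⁸` satisfies `m (k+1) ≤ (1 - c ε) m k + K ε⁵` (`exists_moment_recursion`): in the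
expansion of `‖e'‖⁸` the term of first order in the noise integrates to zero, and the rest is
absorbed by Young's inequality. Holding a stepsize delays it by a bounded factor only, so that
`ε ≍ k ^ (-α)` throughout (`stepsize_bounds`), and the recursion yields `E‖e‖⁸ ≤ P k ^ (-4 α)`
(`exists_rpow_bound_of_recursion`) with `P` depending on the fixed parameters alone. A finite
initial stretch, on which `ε` may exceed `1`, is covered by a crude almost sure bound
(`errorBound`).

By Markov's inequality `‖e‖² ≤ C k ^ (-α / 3)` fails at time `k` with probability at most
`P C⁻⁴ k ^ (-8 α / 3)`. The sum over `k ≥ t₀` is at most a constant times `C⁻⁴ t₀ ^ (-2 α / 3)`,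
since `2 α > 1`, while the first threshold on `t₀` gives `p ≳ t₀ ^ (-2 α / 3)`
(`le_of_threshold₁_le`). A large `C` therefore makes the union bound at most `p`, and almost sure
convergence follows from the Borel–Cantelli lemma (`union_bound_and_borelCantelli`). The eighth
moment is what makes this sum converge fast enough; a second moment would not do. -/

noncomputable section

/-! ### Consensus error and mixing -/

/-- The space `(ℝᵈ)ᴺ` with its Euclidean norm, which is the Frobenius norm of the matrix whose
rows are the agents' variables. -/
abbrev AgentSpace (N d : ℕ) : Type := PiLp 2 fun _ : Fin N => EuclideanSpace ℝ (Fin d)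

/-- The rows `xᵢ - x̄`, as a vector of `AgentSpace N d`. -/
def deviation {N d : ℕ} (x : Fin N → EuclideanSpace ℝ (Fin d)) : AgentSpace N d :=
  WithLp.toLp 2 fun i => x i - average x

/-- The action `(B y)ᵢ = ∑ⱼ Bᵢⱼ yⱼ` of an `N × N` matrix on the agents' variables. -/
def mix {N d : ℕ} (B : Matrix (Fin N) (Fin N) ℝ) (y : Fin N → EuclideanSpace ℝ (Fin d)) :
    AgentSpace N d :=
  WithLp.toLp 2 fun i => ∑ j, B i j • y j

theorem consensusError_eq_norm {N d : ℕ} (x : Fin N → EuclideanSpace ℝ (Fin d)) :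
    consensusError x = ‖deviation x‖ := by
  rw [PiLp.norm_eq_of_L2]
  rfl

theorem norm_toLp_le {N d : ℕ} {y : Fin N → EuclideanSpace ℝ (Fin d)} {b : ℝ}
    (hb : 0 ≤ b) (hy : ∀ i, ‖y i‖ ≤ b) :
    ‖(WithLp.toLp 2 y : AgentSpace N d)‖ ≤ √N * b := by
  rw [PiLp.norm_eq_of_L2]
  apply Real.sqrt_le_iff.2 ⟨by positivity, ?_⟩
  rw [mul_pow, Real.sq_sqrt (Nat.cast_nonneg N)]
  calc ∑ i, ‖y i‖ ^ 2 ≤ ∑ _i : Fin N, b ^ 2 := by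
        gcongr with i
        exact hy i
    _ = N * b ^ 2 := by simp

theorem norm_average_le {N d : ℕ} {y : Fin N → EuclideanSpace ℝ (Fin d)} {b : ℝ}
    (hb : 0 ≤ b) (hy : ∀ i, ‖y i‖ ≤ b) : ‖average y‖ ≤ b := by
  unfold _root_.average
  rw [norm_smul, Real.norm_of_nonneg (by positivity)]
  have h : ‖∑ i, y i‖ ≤ N * b := by
    refine (norm_sum_le _ _).trans ((Finset.sum_le_sum fun i _ => hy i).trans ?_)
    simp
  rcases Nat.eq_zero_or_pos N with rfl | hN
  · simpa using hb
  · have : (0 : ℝ) < N := by exact_mod_cast hN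
    rw [one_div, inv_mul_le_iff₀ this]
    exact h

theorem norm_deviation_le {N d : ℕ} {y : Fin N → EuclideanSpace ℝ (Fin d)} {b : ℝ}
    (hb : 0 ≤ b) (hy : ∀ i, ‖y i‖ ≤ b) : ‖deviation y‖ ≤ √N * (2 * b) :=
  norm_toLp_le (by positivity) fun i =>
    (norm_sub_le _ _).trans (by linarith [hy i, norm_average_le hb hy])

theorem sum_sq_mulVec_le {N : ℕ} (B : Matrix (Fin N) (Fin N) ℝ) (v : Fin N → ℝ) :
    ∑ i, (∑ j, B i j * v j) ^ 2 ≤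
      ‖Matrix.toEuclideanCLM (n := Fin N) (𝕜 := ℝ) B‖ ^ 2 * ∑ i, v i ^ 2 := by
  have h := (Matrix.toEuclideanCLM (n := Fin N) (𝕜 := ℝ) B).le_opNorm (WithLp.toLp 2 v)
  have h2 := pow_le_pow_left₀ (norm_nonneg _) h 2
  rw [mul_pow, EuclideanSpace.norm_sq_eq, EuclideanSpace.norm_sq_eq] at h2
  simpa [Matrix.mulVec, dotProduct] using h2

/-- The operator norm bound holds for the action on `ℝᵈ`-valued vectors, coordinate by
coordinate. -/
theorem norm_mix_le {N d : ℕ} (B : Matrix (Fin N) (Fin N) ℝ)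
    (y : Fin N → EuclideanSpace ℝ (Fin d)) :
    ‖mix B y‖ ≤ ‖Matrix.toEuclideanCLM (n := Fin N) (𝕜 := ℝ) B‖ *
      ‖(WithLp.toLp 2 y : AgentSpace N d)‖ := by
  apply le_of_sq_le_sq _ (by positivity)
  rw [mul_pow, PiLp.norm_sq_eq_of_L2, PiLp.norm_sq_eq_of_L2]
  simp only [mix, EuclideanSpace.norm_sq_eq, Real.norm_eq_abs, sq_abs]
  rw [Finset.sum_comm, Finset.sum_comm (s := Finset.univ (α := Fin N)), Finset.mul_sum]
  refine Finset.sum_le_sum fun c _ => ?_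
  simpa using sum_sq_mulVec_le B fun j => y j c

theorem inner_mix {N d : ℕ} (B : Matrix (Fin N) (Fin N) ℝ) (u : AgentSpace N d)
    (w : Fin N → EuclideanSpace ℝ (Fin d)) :
    inner ℝ u (mix B w) = ∑ j, ∑ c, (∑ i, B i j * u i c) * w j c := by
  simp only [mix, PiLp.inner_apply, RCLike.inner_apply, conj_trivial, WithLp.ofLp_sum,
    Finset.sum_apply, PiLp.smul_apply, smul_eq_mul, Finset.sum_mul]
  rw [Finset.sum_comm]
  conv_rhs => rw [Finset.sum_comm]
  refine Finset.sum_congr rfl fun c _ => ?_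
  rw [Finset.sum_comm]
  refine Finset.sum_congr rfl fun j _ => Finset.sum_congr rfl fun i _ => ?_
  ring

section WeightMatrix

variable {N : ℕ} {A : Matrix (Fin N) (Fin N) ℝ} {s : ℝ}

theorem IsWeightMatrix.row_sum (hA : IsWeightMatrix A s) (i : Fin N) : ∑ j, A i j = 1 := by
  simpa [Matrix.mulVec, dotProduct] using congrFun hA.mulVec_one i

theorem IsWeightMatrix.col_sum (hA : IsWeightMatrix A s) (j : Fin N) : ∑ i, A i j = 1 := by
  simpa [Matrix.vecMul, dotProduct] using congrFun hA.one_vecMul j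

theorem IsWeightMatrix.nonneg (hA : IsWeightMatrix A s) : 0 ≤ s :=
  (norm_nonneg _).trans hA.mixing

/-- One step of the algorithm, seen on the deviations from the average. Averaging removes the
consensual part of every term, which replaces `A` by `A - 𝟏𝟏ᵀ / N`. -/
theorem IsWeightMatrix.deviation_update {d : ℕ} (hA : IsWeightMatrix A s) (ε η : ℝ)
    (x q g x' : Fin N → EuclideanSpace ℝ (Fin d))
    (h : ∀ i, x' i = x i + ε • (∑ j, A i j • (q j - x i)) - η • g i) :
    deviation x' = ((1 - ε) • deviation x + ε • mix (A - averagingMatrix N) (deviation x)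
      - η • deviation g) + ε • mix (A - averagingMatrix N) fun i => q i - x i := by
  rcases Nat.eq_zero_or_pos N with rfl | hN
  · ext i; exact i.elim0
  have hN' : (N : ℝ) ≠ 0 := by exact_mod_cast hN.ne'
  have hx : ∀ i, x' i = (1 - ε) • x i + ε • (∑ j, A i j • q j) - η • g i := by
    intro i
    simp only [h, smul_sub, Finset.sum_sub_distrib, ← Finset.sum_smul, hA.row_sum i, one_smul]
    module
  have hsum : ∑ i, ∑ j, A i j • q j = ∑ j, q j := by
    rw [Finset.sum_comm]
    simp [← Finset.sum_smul, hA.col_sum]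
  have havg : average x' = (1 - ε) • average x + ε • average q - η • average g := by
    simp only [_root_.average, hx, Finset.sum_add_distrib, Finset.sum_sub_distrib,
      ← Finset.smul_sum, hsum]
    module
  have hB : ∀ (i : Fin N) (c : EuclideanSpace ℝ (Fin d)),
      ∑ j, (A i j - 1 / (N : ℝ)) • c = 0 := by
    intro i c
    rw [← Finset.sum_smul, Finset.sum_sub_distrib, hA.row_sum]
    simp [hN']
  have hq : ∀ i, ∑ j, A i j • q j - average q = ∑ j, (A i j - 1 / (N : ℝ)) • q j := by
    intro i
    simp [_root_.average, sub_smul, Finset.sum_sub_distrib, Finset.smul_sum]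
  ext1 i
  simp only [deviation, mix, PiLp.add_apply, PiLp.sub_apply, PiLp.smul_apply, Matrix.sub_apply,
    averagingMatrix, Matrix.of_apply, havg, hx, smul_sub (_ - _ : ℝ), Finset.sum_sub_distrib, hB]
  rw [← hq]
  module

theorem IsWeightMatrix.norm_mix_le {d : ℕ} (hA : IsWeightMatrix A s)
    (y : Fin N → EuclideanSpace ℝ (Fin d)) :
    ‖mix (A - averagingMatrix N) y‖ ≤ s * ‖(WithLp.toLp 2 y : AgentSpace N d)‖ :=
  (_root_.norm_mix_le _ y).trans (by gcongr; exact hA.mixing)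

theorem IsWeightMatrix.abs_rayleigh_le (hA : IsWeightMatrix A s) (v : EuclideanSpace ℝ (Fin N)) :
    |inner ℝ v (Matrix.toEuclideanCLM (n := Fin N) (𝕜 := ℝ) (A - averagingMatrix N) v)| ≤
      s * ‖v‖ ^ 2 := by
  refine (abs_real_inner_le_norm _ _).trans ?_
  have h := (Matrix.toEuclideanCLM (n := Fin N) (𝕜 := ℝ) (A - averagingMatrix N)).le_opNorm v
  have h2 : ‖Matrix.toEuclideanCLM (n := Fin N) (𝕜 := ℝ) (A - averagingMatrix N)‖ ≤ s := hA.mixing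
  nlinarith [norm_nonneg v, mul_le_mul_of_nonneg_right h2 (norm_nonneg v)]

theorem inner_averagingMatrix (v : EuclideanSpace ℝ (Fin N)) :
    inner ℝ v (Matrix.toEuclideanCLM (n := Fin N) (𝕜 := ℝ) (averagingMatrix N) v) =
      1 / (N : ℝ) * (∑ i, v i) ^ 2 := by
  simp only [PiLp.inner_apply, RCLike.inner_apply, conj_trivial, Matrix.ofLp_toEuclideanCLM,
    Matrix.mulVec, dotProduct, averagingMatrix, Matrix.of_apply]
  rw [← Finset.mul_sum, ← Finset.mul_sum]
  ring

/-- The eigenvalues of `A` orthogonal to `𝟏` are those of `A - 𝟏𝟏ᵀ / N`. For the upper bound,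
the span of the first two eigenvectors contains a nonzero vector orthogonal to `𝟏`, on which the
Rayleigh quotient of `A` is at least the second eigenvalue. -/
theorem IsWeightMatrix.secondEigenvalue_mem (hA : IsWeightMatrix A s) (hN : 2 ≤ N) :
    secondEigenvalue A hA.symm hN ∈ Set.Icc (-s) s := by
  set hH := isHermitian_of_isSymm hA.symm
  set b := hH.eigenvectorBasis
  set T := Matrix.toEuclideanCLM (n := Fin N) (𝕜 := ℝ)
  let e := Fintype.equivOfCardEq (Fintype.card_fin (Fintype.card (Fin N)))
  have hc : 2 ≤ Fintype.card (Fin N) := by rw [Fintype.card_fin]; exact hN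
  set i₀ : Fin N := e ⟨0, by omega⟩ with hi₀
  set i₁ : Fin N := e ⟨1, by omega⟩ with hi₁
  have h1 : hH.eigenvalues i₁ = secondEigenvalue A hA.symm hN := by
    simp [Matrix.IsHermitian.eigenvalues, hi₁, e, secondEigenvalue]
  have h01 : hH.eigenvalues i₁ ≤ hH.eigenvalues i₀ := by
    simp only [Matrix.IsHermitian.eigenvalues, hi₁, hi₀, e, Equiv.symm_apply_apply]
    exact hH.eigenvalues₀_antitone (by simp)
  have hT : ∀ i, T A (b i) = hH.eigenvalues i • b i := by
    intro i
    ext1 j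
    have := congrFun (hH.mulVec_eigenvectorBasis i) j
    simpa [T, b] using this
  have hne : i₀ ≠ i₁ := by simp [hi₀, hi₁]
  have hsplit : ∀ v, inner ℝ v (T A v) =
      inner ℝ v (T (A - averagingMatrix N) v) + 1 / (N : ℝ) * (∑ i, v i) ^ 2 := by
    intro v
    rw [← inner_averagingMatrix, ← inner_add_right]
    simp [T]
  rw [← h1]
  constructor
  · have h := hsplit (b i₁)
    have hr := abs_le.1 (hA.abs_rayleigh_le (b i₁))
    rw [hT, inner_smul_right, real_inner_self_eq_norm_sq, b.orthonormal.1 i₁] at h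
    rw [b.orthonormal.1 i₁] at hr
    have : 0 ≤ 1 / (N : ℝ) * (∑ i, b i₁ i) ^ 2 := by positivity
    linarith [hr.1]
  · obtain ⟨p, r, hpr, hsum⟩ : ∃ p r : ℝ, 0 < p ^ 2 + r ^ 2 ∧
        p * (∑ i, b i₀ i) + r * (∑ i, b i₁ i) = 0 := by
      by_cases h0 : (∑ i, b i₀ i) = 0
      · exact ⟨1, 0, by norm_num, by simp [h0]⟩
      · exact ⟨∑ i, b i₁ i, -∑ i, b i₀ i, by
          have : 0 < (-∑ i, b i₀ i) ^ 2 := by rw [neg_sq]; positivity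
          positivity, by ring⟩
    have hnorm : ∀ i, inner ℝ (b i) (b i) = (1 : ℝ) := fun i => by
      rw [real_inner_self_eq_norm_sq, b.orthonormal.1 i]; norm_num
    have horth := b.orthonormal.2 hne
    have horth' := b.orthonormal.2 hne.symm
    have h := hsplit (p • b i₀ + r • b i₁)
    have hv : ∑ i, (p • b i₀ + r • b i₁) i = 0 := by
      simpa [Finset.sum_add_distrib, ← Finset.mul_sum] using hsum
    have hr := (abs_le.1 (hA.abs_rayleigh_le (p • b i₀ + r • b i₁))).2
    rw [hv] at h
    rw [← real_inner_self_eq_norm_sq] at hr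
    rw [map_add, map_smul, map_smul, hT, hT] at h
    simp only [inner_add_left, inner_add_right, inner_smul_left, inner_smul_right, hnorm, horth,
      horth', conj_trivial] at h hr
    have : hH.eigenvalues i₁ * (p ^ 2 + r ^ 2) ≤ s * (p ^ 2 + r ^ 2) := by
      have := mul_le_mul_of_nonneg_right h01 (sq_nonneg p)
      simp only [T] at *
      nlinarith
    exact le_of_mul_le_mul_right this hpr

end WeightMatrix

/-! ### Real inequalities -/

/-- Young's inequality with a parameter, for the exponents `4/3` and `4`. -/
theorem pow_three_mul_le {x y δ : ℝ} (hx : 0 ≤ x) (hy : 0 ≤ y) (hδ : 0 < δ) :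
    x ^ 3 * y ≤ δ * x ^ 4 + y ^ 4 / δ ^ 3 := by
  rcases le_total y (δ * x) with h | h
  · have : x ^ 3 * y ≤ x ^ 3 * (δ * x) := by gcongr
    have : 0 ≤ y ^ 4 / δ ^ 3 := by positivity
    nlinarith
  · have h1 : x ≤ y / δ := by rwa [le_div_iff₀ hδ, mul_comm]
    have : x ^ 3 * y ≤ (y / δ) ^ 3 * y := by gcongr
    have h2 : (y / δ) ^ 3 * y = y ^ 4 / δ ^ 3 := by field_simp
    have : 0 ≤ δ * x ^ 4 := by positivity
    linarith

/-- Fourth power of a perturbation `U + y + z` with `U = a²`: the part of order one in `y` is kept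
exactly, since `y` is centred, and everything else is quadratic in the noise size `b`. -/
theorem add_pow_four_le {a b y z : ℝ} (hy : |y| ≤ 2 * a * b)
    (hz : 0 ≤ z) (hz' : z ≤ b ^ 2) :
    (a ^ 2 + y + z) ^ 4 ≤
      (a ^ 2) ^ 4 + 4 * (a ^ 2) ^ 3 * y + 500 * ((a ^ 2) ^ 3 * b ^ 2 + b ^ 8) := by
  set U := a ^ 2 with hU
  set B := b ^ 2 with hB
  have hU0 : 0 ≤ U := by positivity
  have hB0 : 0 ≤ B := by positivity
  have hy2 : y ^ 2 ≤ 4 * U * B := by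
    have := pow_le_pow_left₀ (abs_nonneg y) hy 2
    rw [sq_abs] at this
    calc y ^ 2 ≤ _ := this
      _ = _ := by rw [hU, hB]; ring
  set Y := y + z with hY
  have hY2 : Y ^ 2 ≤ 8 * U * B + 2 * B ^ 2 := by
    have : z ^ 2 ≤ B ^ 2 := by gcongr
    nlinarith [sq_nonneg (y - z)]
  have hexp : (U + y + z) ^ 4 =
      U ^ 4 + 4 * U ^ 3 * Y + Y ^ 2 * (6 * U ^ 2 + 4 * U * Y + Y ^ 2) := by
    rw [hY]; ring
  have h1 : Y ^ 2 * (6 * U ^ 2 + 4 * U * Y + Y ^ 2) ≤ Y ^ 2 * (8 * U ^ 2 + 3 * Y ^ 2) := by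
    refine mul_le_mul_of_nonneg_left ?_ (sq_nonneg Y)
    nlinarith [sq_nonneg (U - Y)]
  have h2 : Y ^ 2 * (8 * U ^ 2 + 3 * Y ^ 2) ≤
      (8 * U * B + 2 * B ^ 2) * (8 * U ^ 2 + 3 * (8 * U * B + 2 * B ^ 2)) := by gcongr
  have h3 : 4 * U ^ 3 * Y ≤ 4 * U ^ 3 * y + 4 * U ^ 3 * B := by
    have : U ^ 3 * z ≤ U ^ 3 * B := by gcongr
    rw [hY]; linarith
  have hmid : U ^ 2 * B ^ 2 ≤ U ^ 3 * B + B ^ 4 ∧ U * B ^ 3 ≤ U ^ 3 * B + B ^ 4 := by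
    have e1 : 0 ≤ U ^ 3 * B := by positivity
    have e2 : 0 ≤ B ^ 4 := by positivity
    rcases le_total U B with h | h
    · have h1 : U ^ 2 * B ^ 2 ≤ B ^ 2 * B ^ 2 := by gcongr
      have h2 : U * B ^ 3 ≤ B * B ^ 3 := by gcongr
      exact ⟨by nlinarith, by nlinarith⟩
    · have h1 : U ^ 2 * B * B ≤ U ^ 2 * B * U := by gcongr
      have h2 : U * B * B ^ 2 ≤ U * B * U ^ 2 := by gcongr
      exact ⟨by nlinarith, by nlinarith⟩
  have hb8 : b ^ 8 = B ^ 4 := by rw [hB]; ring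
  have e1 : 0 ≤ U ^ 3 * B := by positivity
  have e2 : 0 ≤ B ^ 4 := by positivity
  rw [hexp, hb8]
  nlinarith [hmid.1, hmid.2]

/-- Jensen's inequality for the eighth power. -/
theorem convex_comb_pow_eight_le {θ v r : ℝ} (hθ : 0 ≤ θ) (hθ' : θ ≤ 1) (hv : 0 ≤ v) (hr : 0 ≤ r) :
    ((1 - θ) * v + θ * r) ^ 8 ≤ (1 - θ) * v ^ 8 + θ * r ^ 8 :=
  (convexOn_pow 8).2 hv hr (sub_nonneg.2 hθ') hθ (by ring)

/-- The one-step contraction of the eighth power, with the cross term `y` kept. Here `v` is the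
size of the error, `a` its size after the averaging and gradient steps, and `e Z` the size of the
noise. The gradient contributes at most `η g`, which is small against `e κ` because `η² ≲ e³`. -/
theorem exists_pow_eight_recursion (κ g Z H : ℝ) (hκ : 0 < κ) (hg : 0 ≤ g) :
    ∃ K, 0 ≤ K ∧ ∀ e η v a y z : ℝ, 0 < e → 0 ≤ η → η ^ 2 ≤ H * e ^ 3 → κ * e ≤ 1 →
      0 ≤ v → 0 ≤ a → a ≤ (1 - κ * e) * v + η * g →
      |y| ≤ 2 * a * (e * Z) → 0 ≤ z → z ≤ (e * Z) ^ 2 →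
      (a ^ 2 + y + z) ^ 4 ≤ (1 - κ / 2 * e) * v ^ 8 + K * e ^ 5 + 4 * (a ^ 2) ^ 3 * y := by
  set δ : ℝ := κ / (1000 * (Z ^ 2 + 1)) with hδ
  have hδ0 : 0 < δ := by positivity
  set K₁ : ℝ := κ * (g ^ 2 * H / κ ^ 2) ^ 4 with hK₁
  have hK₁0 : 0 ≤ K₁ := by positivity
  refine ⟨(1 + 1 / 2) * K₁ + 500 * (Z ^ 2 / δ ^ 3 + Z ^ 8 / κ ^ 3), by positivity, ?_⟩
  intro e η v a y z he hη hηe hκe hv ha hav hy hz hz'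
  have h1 := add_pow_four_le hy hz hz'
  have hθ : 0 ≤ κ * e := by positivity
  have hr0 : 0 ≤ η * g / (κ * e) := by positivity
  have ha8 : a ^ 8 ≤ (1 - κ * e) * v ^ 8 + K₁ * e ^ 5 := by
    have hr : (η * g / (κ * e)) ^ 8 ≤ (g ^ 2 * H / κ ^ 2) ^ 4 * e ^ 4 := by
      have : (η * g / (κ * e)) ^ 2 ≤ g ^ 2 * H / κ ^ 2 * e := by
        rw [div_pow, div_mul_eq_mul_div, div_le_div_iff₀ (by positivity) (by positivity)]
        calc (η * g) ^ 2 * κ ^ 2 = η ^ 2 * (g ^ 2 * κ ^ 2) := by ring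
          _ ≤ H * e ^ 3 * (g ^ 2 * κ ^ 2) := by gcongr
          _ = _ := by ring
      calc (η * g / (κ * e)) ^ 8 = ((η * g / (κ * e)) ^ 2) ^ 4 := by ring
        _ ≤ (g ^ 2 * H / κ ^ 2 * e) ^ 4 := by gcongr
        _ = _ := by ring
    calc a ^ 8 ≤ ((1 - κ * e) * v + κ * e * (η * g / (κ * e))) ^ 8 := by
          gcongr
          rwa [mul_div_cancel₀ _ (by positivity)]
      _ ≤ (1 - κ * e) * v ^ 8 + κ * e * (η * g / (κ * e)) ^ 8 :=
          convex_comb_pow_eight_le hθ hκe hv hr0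
      _ ≤ (1 - κ * e) * v ^ 8 + κ * e * ((g ^ 2 * H / κ ^ 2) ^ 4 * e ^ 4) := by gcongr
      _ = _ := by rw [hK₁]; ring
  have hY : (a ^ 2) ^ 3 * (e * Z) ^ 2 ≤ δ * Z ^ 2 * e * a ^ 8 + Z ^ 2 / δ ^ 3 * e ^ 5 := by
    have := mul_le_mul_of_nonneg_left (pow_three_mul_le (sq_nonneg a) he.le hδ0)
      (by positivity : 0 ≤ Z ^ 2 * e)
    calc _ = Z ^ 2 * e * ((a ^ 2) ^ 3 * e) := by ring
      _ ≤ _ := this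
      _ = _ := by ring
  have hZ8 : (e * Z) ^ 8 ≤ Z ^ 8 / κ ^ 3 * e ^ 5 := by
    have : e ^ 3 ≤ 1 / κ ^ 3 := by
      rw [le_div_iff₀ (by positivity), ← mul_pow, mul_comm]
      exact pow_le_one₀ hθ hκe
    calc (e * Z) ^ 8 = Z ^ 8 * e ^ 5 * e ^ 3 := by ring
      _ ≤ Z ^ 8 * e ^ 5 * (1 / κ ^ 3) := by gcongr
      _ = _ := by ring
  have hδZ : 500 * (δ * Z ^ 2) ≤ κ / 2 := by
    have : δ * (1000 * (Z ^ 2 + 1)) = κ := by rw [hδ]; field_simp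
    nlinarith
  have hfin : (1 + 500 * (δ * Z ^ 2) * e) * a ^ 8 ≤
      (1 + κ / 2 * e) * ((1 - κ * e) * v ^ 8 + K₁ * e ^ 5) := by gcongr
  have hc : (1 + κ / 2 * e) * ((1 - κ * e) * v ^ 8) ≤ (1 - κ / 2 * e) * v ^ 8 := by
    rw [← mul_assoc]
    gcongr
    nlinarith
  have hc' : (1 + κ / 2 * e) * (K₁ * e ^ 5) ≤ (1 + 1 / 2) * (K₁ * e ^ 5) := by
    gcongr
    linarith
  have e8 : (a ^ 2) ^ 4 = a ^ 8 := by ring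
  rw [e8] at h1
  linarith

/-- A sequence with `m (k+1) ≤ (1 - c e k) m k + K (e k)^5` and `e k ≍ k^(-α)`, `α < 1`, decays like
`k^(-4α)`, because `(e k)^4` varies slowly against the contraction rate. The constant does not
depend on the sequence, only on bounds for its terms and on the parameters. -/
theorem exists_rpow_bound_of_recursion (α a b c K : ℝ) (hα : 0 < α) (hα' : α < 1) (ha : 0 < a)
    (hc : 0 < c) (hK : 0 ≤ K) (M : ℕ → ℝ) :
    ∃ P, 0 < P ∧ ∀ e m : ℕ → ℝ,
      (∀ k : ℕ, 1 ≤ k → a * (k : ℝ) ^ (-α) ≤ e k) → (∀ k : ℕ, 1 ≤ k → e k ≤ b * (k : ℝ) ^ (-α)) →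
      (∀ k, 0 ≤ m k) → (∀ k, m k ≤ M k) →
      (∀ k, e k ≤ 1 → m (k + 1) ≤ (1 - c * e k) * m k + K * e k ^ 5) →
      ∀ k : ℕ, 1 ≤ k → m k ≤ P * (k : ℝ) ^ (-4 * α) := by
  have htend : Tendsto (fun k : ℕ => (k : ℝ) ^ (-α)) atTop (𝓝 0) :=
    (tendsto_rpow_neg_atTop hα).comp tendsto_natCast_atTop_atTop
  have htend' : Tendsto (fun k : ℕ => (k : ℝ) ^ (-(1 - α))) atTop (𝓝 0) :=
    (tendsto_rpow_neg_atTop (sub_pos.2 hα')).comp tendsto_natCast_atTop_atTop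
  have h0 : ∀ᶠ k : ℕ in atTop, b * (k : ℝ) ^ (-α) ≤ 1 := by
    have : Tendsto (fun k : ℕ => b * (k : ℝ) ^ (-α)) atTop (𝓝 0) := by
      simpa using htend.const_mul b
    exact this.eventually_le_const one_pos
  have h1 : ∀ᶠ k : ℕ in atTop, c * (b * (k : ℝ) ^ (-α)) ≤ 1 := by
    have : Tendsto (fun k : ℕ => c * (b * (k : ℝ) ^ (-α))) atTop (𝓝 0) := by
      simpa using (htend.const_mul b).const_mul c
    exact this.eventually_le_const one_pos
  have h2 : ∀ᶠ k : ℕ in atTop, (k : ℝ) ^ (-(1 - α)) ≤ c * a / 8 :=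
    htend'.eventually_le_const (by positivity)
  obtain ⟨k₀, hk₀⟩ := eventually_atTop.1 (((h0.and h1).and h2).and (eventually_ge_atTop 1))
  set P : ℝ := 1 + 2 * K * |b| ^ 5 / (c * a) +
    ∑ j ∈ Finset.range (k₀ + 1), |M j| * (j : ℝ) ^ (4 * α) with hP
  have hsum : 0 ≤ ∑ j ∈ Finset.range (k₀ + 1), |M j| * (j : ℝ) ^ (4 * α) :=
    Finset.sum_nonneg fun j _ => by positivity
  have hq : 0 ≤ 2 * K * |b| ^ 5 / (c * a) := by positivity
  refine ⟨P, by positivity, ?_⟩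
  intro e m hae heb hm hmM hrec k hk
  -- The early terms are bounded by `M`; from `k₀` on the bound is inductive.
  have hearly : ∀ k : ℕ, 1 ≤ k → k ≤ k₀ → m k ≤ P * (k : ℝ) ^ (-4 * α) := by
    intro k hk hkk
    have hkpos : (0 : ℝ) < k := by exact_mod_cast hk
    have hs := Finset.single_le_sum (f := fun j : ℕ => |M j| * (j : ℝ) ^ (4 * α))
      (fun j _ => by positivity) (Finset.mem_range.2 (Nat.lt_succ_of_le hkk))
    have hPk : |M k| * (k : ℝ) ^ (4 * α) ≤ P := by
      linarith
    calc m k ≤ |M k| := (hmM k).trans (le_abs_self _)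
      _ = |M k| * (k : ℝ) ^ (4 * α) * (k : ℝ) ^ (-4 * α) := by
          rw [mul_assoc, ← Real.rpow_add hkpos]; simp
      _ ≤ _ := by gcongr
  rcases le_total k k₀ with hkk | hkk
  · exact hearly k hk hkk
  induction k, hkk using Nat.le_induction with
  | base => exact hearly _ hk le_rfl
  | succ k hkk ih =>
    obtain ⟨⟨⟨g0, g1⟩, g2⟩, g3⟩ := hk₀ k hkk
    have ih := ih g3
    have hkpos : (0 : ℝ) < k := by exact_mod_cast g3
    set X := (k : ℝ) ^ (-α) with hX
    have hX0 : 0 < X := Real.rpow_pos_of_pos hkpos _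
    have hX4 : (k : ℝ) ^ (-4 * α) = X ^ 4 := by
      rw [hX, ← Real.rpow_natCast, ← Real.rpow_mul hkpos.le]; congr 1; push_cast; ring
    have hinv : 1 / (k : ℝ) ≤ c * a / 8 * X := by
      have : (1 : ℝ) / k = (k : ℝ) ^ (-(1 - α)) * X := by
        rw [hX, ← Real.rpow_add hkpos, one_div, ← Real.rpow_neg_one]; congr 1; ring
      rw [this]
      gcongr
    have hbern : X ^ 4 * (1 - 4 / k) ≤ ((k + 1 : ℕ) : ℝ) ^ (-4 * α) := by
      have hb1 : 1 - 4 / (k : ℝ) ≤ (1 + 1 / (k : ℝ)) ^ (-4 * α) := by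
        have hb2 : (1 + 1 / (k : ℝ)) ^ (4 * α) ≤ (1 + 1 / (k : ℝ)) ^ (4 : ℝ) := by
          apply Real.rpow_le_rpow_of_exponent_le
          · have : 0 ≤ 1 / (k : ℝ) := by positivity
            linarith
          · linarith
        have hb3 : 1 - 4 / (k : ℝ) ≤ ((1 + 1 / (k : ℝ)) ^ 4)⁻¹ := by
          have h := one_add_mul_le_pow (a := -(1 / ((k : ℝ) + 1))) (by
            have : 1 / ((k : ℝ) + 1) ≤ 1 := by
              rw [div_le_one (by positivity)]; linarith
            linarith) 4
          have h4 : (1 + -(1 / ((k : ℝ) + 1))) ^ 4 = ((1 + 1 / (k : ℝ)) ^ 4)⁻¹ := by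
            rw [← inv_pow]; congr 1; field_simp; ring
          rw [← h4]
          have : 1 / ((k : ℝ) + 1) ≤ 1 / k := by gcongr; linarith
          have : 4 / (k : ℝ) = 4 * (1 / k) := by ring
          push_cast at h
          linarith
        rw [show -4 * α = -(4 * α) by ring, Real.rpow_neg (by positivity)]
        refine hb3.trans ?_
        gcongr
        exact hb2.trans_eq (by norm_cast)
      have : ((k + 1 : ℕ) : ℝ) = k * (1 + 1 / (k : ℝ)) := by
        push_cast; field_simp
      rw [this, Real.mul_rpow hkpos.le (by positivity), hX4]
      gcongr
    have hek1 := hae k g3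
    have hek2 := heb k g3
    have hek0 : 0 ≤ e k := le_trans (by positivity) hek1
    have hce : c * e k ≤ 1 := (by gcongr : c * e k ≤ c * (b * X)).trans g1
    have hPK : 2 * K * |b| ^ 5 ≤ P * (c * a) := by
      rw [← div_le_iff₀ (by positivity)]; linarith
    have he5 : e k ^ 5 ≤ |b| ^ 5 * X ^ 5 := by
      rw [← mul_pow]
      gcongr
      exact hek2.trans (by gcongr; exact le_abs_self b)
    have hP0 : 0 < P := by positivity
    calc m (k + 1) ≤ (1 - c * e k) * m k + K * e k ^ 5 := hrec k (hek2.trans g0)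
      _ ≤ (1 - c * e k) * (P * X ^ 4) + K * (|b| ^ 5 * X ^ 5) := by
          rw [← hX4]
          gcongr
      _ ≤ (1 - c * (a * X)) * (P * X ^ 4) + P * (c * a) / 2 * X ^ 5 := by
          have : K * (|b| ^ 5 * X ^ 5) = 2 * K * |b| ^ 5 / 2 * X ^ 5 := by ring
          rw [this]
          gcongr
      _ = P * (X ^ 4 * (1 - c * a / 2 * X)) := by ring
      _ ≤ P * (X ^ 4 * (1 - 4 / k)) := by
          have : 4 / (k : ℝ) = 4 * (1 / k) := by ring
          gcongr
          linarith
      _ ≤ _ := by gcongr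

/-! ### Stepsizes -/

section Stepsize

variable {c₁ c₂ : ℝ}

theorem refStep_pos (hc₁ : 0 < c₁) (hc₂ : 0 < c₂) (b : ℝ) (n : ℕ) : 0 < refStep c₁ c₂ b n := by
  unfold refStep; positivity

theorem refStep_le (hc₁ : 0 < c₁) (hc₂ : 0 < c₂) (b : ℝ) (n : ℕ) : refStep c₁ c₂ b n ≤ c₁ := by
  unfold refStep
  apply div_le_self hc₁.le
  have : 0 ≤ c₂ * (n : ℝ) ^ b := by positivity
  linarith

/-- The two stepsizes at the same time satisfy `η² ≲ ε³`, since `3 α ≤ 2 β`. -/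
theorem refStep_sq_le {α β : ℝ} (hα : 0 < α) (hβ : 3 / 2 * α < β)
    (hc₁ : 0 < c₁) (hc₂ : 0 < c₂) (n : ℕ) :
    refStep c₁ c₂ β n ^ 2 ≤
      ((1 + (1 + c₂) ^ 3 / c₂ ^ 2) / c₁) * refStep c₁ c₂ α n ^ 3 := by
  have key : (1 + c₂ * (n : ℝ) ^ α) ^ 3 ≤
      (1 + (1 + c₂) ^ 3 / c₂ ^ 2) * (1 + c₂ * (n : ℝ) ^ β) ^ 2 := by
    have hF : 0 ≤ (1 + c₂) ^ 3 / c₂ ^ 2 := by positivity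
    rcases Nat.eq_zero_or_pos n with rfl | hn
    · have hβ0 : β ≠ 0 := by linarith
      simp [hα.ne', hβ0]; positivity
    · have h1 : (1 : ℝ) ≤ n := by exact_mod_cast hn
      have h2 : (1 : ℝ) ≤ (n : ℝ) ^ α := Real.one_le_rpow h1 hα.le
      have h3 : ((n : ℝ) ^ α) ^ 3 ≤ ((n : ℝ) ^ β) ^ 2 := by
        rw [← Real.rpow_natCast, ← Real.rpow_mul (by positivity), ← Real.rpow_natCast,
          ← Real.rpow_mul (by positivity)]
        apply Real.rpow_le_rpow_of_exponent_le h1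
        push_cast; linarith
      calc (1 + c₂ * (n : ℝ) ^ α) ^ 3 ≤ ((1 + c₂) * (n : ℝ) ^ α) ^ 3 := by
            gcongr; linarith
        _ = (1 + c₂) ^ 3 * ((n : ℝ) ^ α) ^ 3 := by ring
        _ ≤ (1 + c₂) ^ 3 * ((n : ℝ) ^ β) ^ 2 := by gcongr
        _ = (1 + c₂) ^ 3 / c₂ ^ 2 * (c₂ * (n : ℝ) ^ β) ^ 2 := by field_simp
        _ ≤ (1 + (1 + c₂) ^ 3 / c₂ ^ 2) * (1 + c₂ * (n : ℝ) ^ β) ^ 2 := by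
            gcongr <;> linarith
  unfold refStep
  rw [div_pow, div_pow, div_mul_div_comm, div_le_div_iff₀ (by positivity) (by positivity)]
  calc c₁ ^ 2 * (c₁ * (1 + c₂ * (n : ℝ) ^ α) ^ 3) = c₁ ^ 3 * (1 + c₂ * (n : ℝ) ^ α) ^ 3 := by ring
    _ ≤ c₁ ^ 3 * ((1 + (1 + c₂) ^ 3 / c₂ ^ 2) * (1 + c₂ * (n : ℝ) ^ β) ^ 2) := by gcongr
    _ = _ := by ring

/-- Holding a stepsize delays it by a bounded factor only: the hold at time `τ ≥ 1` has length
`O(τ ^ α) = O(τ)`. -/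
theorem heldTime_bounds {α ρ ε : ℝ} (hα : α ≤ 1) (hc₁ : 0 < c₁) (hc₂ : 0 < c₂)
    {t₀ : ℕ} (ht₀ : 1 ≤ t₀) (I k : ℕ) :
    heldTime (holdTime c₁ c₂ α ρ ε t₀) I k ≤ k ∧
      (k : ℝ) ≤ (2 + (1 + c₂) / (c₁ * √(ρ * ε))) *
        heldTime (holdTime c₁ c₂ α ρ ε t₀) I k := by
  set t := holdTime c₁ c₂ α ρ ε t₀ with ht
  set F := (1 + c₂) / (c₁ * √(ρ * ε)) with hF
  have hF0 : 0 ≤ F := by positivity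
  unfold heldTime
  split_ifs with h
  · refine ⟨le_rfl, ?_⟩
    have : (0 : ℝ) ≤ k := by positivity
    nlinarith
  · push Not at h
    set n := Nat.findGreatest (fun i => t i ≤ k) I with hn
    have hnk : t n ≤ k := Nat.findGreatest_spec (P := fun i => t i ≤ k) (Nat.zero_le I) h.1
    have hnI : n < I := lt_of_le_of_ne (Nat.findGreatest_le I) fun h' => by
      rw [h'] at hnk; omega
    have hk : k < t (n + 1) := by
      by_contra! hcon
      exact Nat.findGreatest_is_greatest (P := fun i => t i ≤ k) (Nat.lt_succ_self n)
        hnI hcon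
    have hmono : Monotone t := monotone_nat_of_le_succ fun i => by simp [ht, holdTime]
    have hτ : (1 : ℝ) ≤ t n := by
      have : t₀ ≤ t n := hmono (Nat.zero_le n)
      exact_mod_cast ht₀.trans this
    refine ⟨hnk, ?_⟩
    have hsucc : t (n + 1) = t n + ⌈(1 + c₂ * (t n : ℝ) ^ α) / (c₁ * √(ρ * ε))⌉₊ := rfl
    have hceil := Nat.ceil_lt_add_one
      (by positivity : 0 ≤ (1 + c₂ * (t n : ℝ) ^ α) / (c₁ * √(ρ * ε)))
    have hpow : (t n : ℝ) ^ α ≤ t n := by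
      simpa using Real.rpow_le_rpow_of_exponent_le hτ hα
    have hle : (1 + c₂ * (t n : ℝ) ^ α) / (c₁ * √(ρ * ε)) ≤ F * t n := by
      rw [hF, div_mul_eq_mul_div]
      gcongr
      nlinarith
    have hk' : (k : ℝ) ≤ t (n + 1) := by exact_mod_cast hk.le
    rw [hsucc] at hk'
    push_cast at hk'
    nlinarith

/-- The held stepsize is of the exact order `k ^ (-b)`, whatever the holding times. -/
theorem stepsize_bounds {α b ρ ε : ℝ} (hα : α ≤ 1) (hb : 0 < b) (hc₁ : 0 < c₁) (hc₂ : 0 < c₂)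
    {t₀ : ℕ} (ht₀ : 1 ≤ t₀) (I : ℕ) {k : ℕ} (hk : 1 ≤ k) :
    c₁ / (1 + c₂) * (k : ℝ) ^ (-b) ≤ stepsize c₁ c₂ b (holdTime c₁ c₂ α ρ ε t₀) I k ∧
      stepsize c₁ c₂ b (holdTime c₁ c₂ α ρ ε t₀) I k ≤
        c₁ / c₂ * (2 + (1 + c₂) / (c₁ * √(ρ * ε))) ^ b * (k : ℝ) ^ (-b) := by
  obtain ⟨h1, h2⟩ := heldTime_bounds (ρ := ρ) (ε := ε) hα hc₁ hc₂ ht₀ I k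
  unfold stepsize refStep
  set τ := heldTime (holdTime c₁ c₂ α ρ ε t₀) I k
  set F := 2 + (1 + c₂) / (c₁ * √(ρ * ε)) with hF
  have hF0 : 0 < F := by positivity
  have hk1 : (1 : ℝ) ≤ k := by exact_mod_cast hk
  have hk0 : (0 : ℝ) < k := by linarith
  have hτ : (0 : ℝ) < τ := by
    by_contra! hcon
    nlinarith
  have h1' : (τ : ℝ) ≤ k := by exact_mod_cast h1
  have hpow : (τ : ℝ) ^ b ≤ (k : ℝ) ^ b := by gcongr
  have hpow1 : (1 : ℝ) ≤ (k : ℝ) ^ b := Real.one_le_rpow hk1 hb.le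
  have hpowF : (k : ℝ) ^ b ≤ F ^ b * (τ : ℝ) ^ b := by
    rw [← Real.mul_rpow hF0.le hτ.le]; gcongr
  rw [Real.rpow_neg hk0.le]
  constructor
  · rw [← div_eq_mul_inv, div_div]
    gcongr
    nlinarith
  · rw [← div_eq_mul_inv, div_le_div_iff₀ (by positivity) (by positivity)]
    have : 0 < F ^ b := by positivity
    calc c₁ * (k : ℝ) ^ b ≤ c₁ * (F ^ b * (τ : ℝ) ^ b) := by gcongr
      _ = c₁ / c₂ * F ^ b * (c₂ * (τ : ℝ) ^ b) := by field_simp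
      _ ≤ _ := by gcongr; linarith

/-- The first threshold forces `t₀ ≥ 1` and bounds the confidence parameter `p` below by a multiple
of `t₀ ^ (-2 α / 3)`, with a factor depending only on `c₁`, `c₂` and `G`. -/
theorem le_of_threshold₁_le {N d : ℕ} {α p σ G ℓ : ℝ} (hα : 0 < α) (hc₁ : 0 < c₁) (hc₂ : 0 < c₂)
    (hG : 0 < G) (hp : 0 < p) (hσ : σ ∈ Set.Ico (-1) 1) {t₀ : ℕ}
    (ht₀ : threshold₁ α c₁ c₂ p σ (noiseConst N d (refStep c₁ c₂ α 0) σ G ℓ) ≤ t₀) :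
    1 ≤ t₀ ∧ c₁ ^ (2 / 3 : ℝ) * G ^ 2 / c₂ ^ (2 / 3 : ℝ) * (t₀ : ℝ) ^ (-(2 * α / 3)) ≤ p := by
  have hε : 0 < refStep c₁ c₂ α 0 := by simpa using refStep_pos hc₁ hc₂ α 0
  set D := noiseConst N d (refStep c₁ c₂ α 0) σ G ℓ with hD
  have hσ0 : 0 < 1 - σ := by linarith [hσ.2]
  have hD0 : G ^ 2 / (1 - σ) ≤ D := by
    have h1 : G ^ 2 / (1 - σ) ≤ (1 + (1 - σ) * refStep c₁ c₂ α 0) / (1 - σ) * G ^ 2 := by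
      rw [div_mul_eq_mul_div]
      gcongr
      have : 0 ≤ (1 - σ) * refStep c₁ c₂ α 0 * G ^ 2 := by positivity
      nlinarith
    have h2 : 0 ≤ (1 + (1 - σ) * refStep c₁ c₂ α 0) * σ ^ 2 * N * d * ℓ ^ 2 := by positivity
    rw [hD, noiseConst]; linarith
  have hDpos : 0 < D := lt_of_lt_of_le (by positivity) hD0
  set Y := 4 * c₁ ^ (2 / 3 : ℝ) * D / (p * c₂ ^ (2 / 3 : ℝ) * (1 - σ)) with hY
  have hY0 : 0 < Y := by positivity
  have hY1 : c₁ ^ (2 / 3 : ℝ) * G ^ 2 / c₂ ^ (2 / 3 : ℝ) ≤ p * Y := by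
    have hD4 : G ^ 2 ≤ 4 * D / (1 - σ) := by
      rw [le_div_iff₀ hσ0]
      have h3 : G ^ 2 ≤ D * (1 - σ) := by rwa [div_le_iff₀ hσ0] at hD0
      nlinarith [hσ.1, sq_nonneg G]
    calc c₁ ^ (2 / 3 : ℝ) * G ^ 2 / c₂ ^ (2 / 3 : ℝ)
        ≤ c₁ ^ (2 / 3 : ℝ) * (4 * D / (1 - σ)) / c₂ ^ (2 / 3 : ℝ) := by gcongr
      _ = p * Y := by rw [hY]; field_simp
  have hpos : 0 < threshold₁ α c₁ c₂ p σ D := by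
    unfold threshold₁; exact Real.rpow_pos_of_pos hY0 _
  have ht : (0 : ℝ) < t₀ := hpos.trans_le ht₀
  refine ⟨by exact_mod_cast ht, ?_⟩
  have hYt : Y ≤ (t₀ : ℝ) ^ (2 * α / 3) := by
    have h := Real.rpow_le_rpow hpos.le ht₀ (by positivity : 0 ≤ 2 * α / 3)
    unfold threshold₁ at h
    rw [← Real.rpow_mul hY0.le] at h
    have e : 3 / (2 * α) * (2 * α / 3) = 1 := by field_simp
    rwa [e, Real.rpow_one] at h
  rw [Real.rpow_neg ht.le, ← div_eq_mul_inv, div_le_iff₀ (by positivity)]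
  exact hY1.trans (by gcongr)

end Stepsize

/-! ### Quantization noise -/

theorem sub_quantLower {ℓ : ℝ} (hℓ : ℓ ≠ 0) (k : ℕ) (v : ℝ) :
    v - quantLower ℓ k v = ℓ * quantProb ℓ k v := by
  unfold quantLower quantProb
  split_ifs
  · field_simp
  · field_simp; ring

theorem quantProb_mem (ℓ : ℝ) (k : ℕ) (v : ℝ) : quantProb ℓ k v ∈ Set.Icc 0 1 := by
  unfold quantProb
  split_ifs
  · constructor <;> linarith [Int.floor_le (v / ℓ), Int.lt_floor_add_one (v / ℓ)]
  · constructor <;> linarith [Int.floor_le (v / ℓ + 1 / 2), Int.lt_floor_add_one (v / ℓ + 1 / 2)]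

theorem measurable_quantLower (ℓ : ℝ) (k : ℕ) : Measurable (quantLower ℓ k) := by
  unfold quantLower
  split_ifs <;> fun_prop

/-- A variable `y` rounded to two points `lo`, `lo + ℓ` around `v`, with conditional probabilities
making the rounding unbiased, differs from `v` by at most `ℓ`, and by a conditionally centred
amount. -/
theorem unbiased_rounding {Ω : Type*} {m mΩ : MeasurableSpace Ω} {μ : Measure Ω}
    [IsProbabilityMeasure μ] (hm : m ≤ mΩ) {ℓ : ℝ} (hℓ : 0 < ℓ) {v lo pr y : Ω → ℝ}
    (hlo : Measurable lo) (hy : Measurable y)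
    (hv : ∀ ω, v ω - lo ω = ℓ * pr ω) (hpr : ∀ ω, pr ω ∈ Set.Icc (0 : ℝ) 1)
    (hup : μ⟦{ω | y ω = lo ω + ℓ} | m⟧ =ᵐ[μ] pr)
    (hdown : μ⟦{ω | y ω = lo ω} | m⟧ =ᵐ[μ] fun ω => 1 - pr ω) :
    (∀ᵐ ω ∂μ, |y ω - v ω| ≤ ℓ) ∧
      ∀ (h : Ω → ℝ) (b : ℝ), StronglyMeasurable[m] h → (∀ᵐ ω ∂μ, |h ω| ≤ b) →
        Integrable (fun ω => h ω * (y ω - v ω)) μ ∧ ∫ ω, h ω * (y ω - v ω) ∂μ = 0 := by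
  set U := {ω | y ω = lo ω + ℓ}
  set L := {ω | y ω = lo ω}
  have hU : MeasurableSet U := measurableSet_eq_fun hy (hlo.add_const ℓ)
  have hL : MeasurableSet L := measurableSet_eq_fun hy hlo
  have hprint : Integrable pr μ := integrable_condExp.congr hup
  have hμU : μ.real U = ∫ ω, pr ω ∂μ := by
    rw [← integral_congr_ae hup, integral_condExp hm, integral_indicator_const _ hU]
    simp
  have hμL : μ.real L = 1 - ∫ ω, pr ω ∂μ := by
    have : ∫ ω, (1 - pr ω) ∂μ = 1 - ∫ ω, pr ω ∂μ := by
      rw [integral_sub (integrable_const _) hprint]; simp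
    rw [← this, ← integral_congr_ae hdown, integral_condExp hm, integral_indicator_const _ hL]
    simp
  have hdisj : Disjoint U L := by
    rw [Set.disjoint_left]
    intro ω h1 h2
    have h1 : y ω = lo ω + ℓ := h1
    have h2 : y ω = lo ω := h2
    linarith
  have hUL : ∀ᵐ ω ∂μ, ω ∈ U ∪ L := by
    have h1 : μ.real (U ∪ L) = 1 := by
      rw [measureReal_union hdisj hL, hμU, hμL]; ring
    refine (mem_ae_iff_prob_eq_one (hU.union hL)).2 ?_
    rw [← ofReal_measureReal, h1, ENNReal.ofReal_one]
  have hw : (fun ω => y ω - v ω) =ᵐ[μ] fun ω => ℓ * (U.indicator (fun _ => (1 : ℝ)) ω - pr ω) := by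
    filter_upwards [hUL] with ω hω
    have hvω := hv ω
    rcases hω with hω | hω
    · have h1 : y ω = lo ω + ℓ := hω
      rw [Set.indicator_of_mem hω]; linarith
    · have h1 : y ω = lo ω := hω
      rw [Set.indicator_of_notMem (hdisj.notMem_of_mem_right hω)]; linarith
  refine ⟨?_, fun h b hh hb => ?_⟩
  · filter_upwards [hw] with ω hω
    rw [hω, abs_mul, abs_of_pos hℓ]
    apply mul_le_of_le_one_right hℓ.le
    obtain ⟨h0, h1⟩ := hpr ω
    rw [abs_le]
    by_cases hωU : ω ∈ U
    · rw [Set.indicator_of_mem hωU]; constructor <;> linarith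
    · rw [Set.indicator_of_notMem hωU]; constructor <;> linarith
  · have hhm : AEStronglyMeasurable h μ := (hh.mono hm).aestronglyMeasurable
    have hind : Integrable (U.indicator fun _ => (1 : ℝ)) μ := (integrable_const 1).indicator hU
    have hi1 : Integrable (fun ω => h ω * U.indicator (fun _ => (1 : ℝ)) ω) μ :=
      hind.bdd_mul hhm hb
    have hi2 : Integrable (fun ω => h ω * pr ω) μ := hprint.bdd_mul hhm hb
    have heq : ∫ ω, h ω * U.indicator (fun _ => (1 : ℝ)) ω ∂μ = ∫ ω, h ω * pr ω ∂μ := by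
      rw [← integral_condExp hm]
      apply integral_congr_ae
      refine (condExp_mul_of_stronglyMeasurable_left hh hi1 hind).trans ?_
      filter_upwards [hup] with ω hω
      simp only [Pi.mul_apply]
      rw [hω]
    have hw' : (fun ω => h ω * (y ω - v ω)) =ᵐ[μ]
        fun ω => ℓ * (h ω * U.indicator (fun _ => (1 : ℝ)) ω - h ω * pr ω) := by
      filter_upwards [hw] with ω hω
      rw [hω]; ring
    refine ⟨((hi1.sub hi2).const_mul ℓ).congr hw'.symm, ?_⟩
    rw [integral_congr_ae hw', integral_const_mul, integral_sub hi1 hi2, heq]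
    simp

/-! ### Moments of the consensus error -/

theorem measurable_euclidean {Ω : Type*} {m : MeasurableSpace Ω} {d : ℕ}
    {y : Ω → EuclideanSpace ℝ (Fin d)} (hy : ∀ c, Measurable fun ω => y ω c) : Measurable y :=
  (PiLp.continuous_toLp 2 fun _ : Fin d => ℝ).measurable.comp (measurable_pi_lambda _ hy)

theorem measurable_deviation {Ω : Type*} {m : MeasurableSpace Ω} {N d : ℕ}
    {y : Ω → Fin N → EuclideanSpace ℝ (Fin d)} (hy : ∀ i, Measurable fun ω => y ω i) (i : Fin N) :
    Measurable fun ω => deviation (y ω) i := by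
  simp only [deviation, _root_.average]
  fun_prop

theorem measurable_mix {Ω : Type*} {m : MeasurableSpace Ω} {N d : ℕ}
    (B : Matrix (Fin N) (Fin N) ℝ)
    {y : Ω → Fin N → EuclideanSpace ℝ (Fin d)} (hy : ∀ i, Measurable fun ω => y ω i) (i : Fin N) :
    Measurable fun ω => mix B (y ω) i := by
  simp only [mix]
  fun_prop

theorem measurable_norm_agentSpace {Ω : Type*} {m : MeasurableSpace Ω} {N d : ℕ}
    {y : Ω → AgentSpace N d} (hy : ∀ i, Measurable fun ω => y ω i) :
    Measurable fun ω => ‖y ω‖ := by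
  have h : (fun ω => ‖y ω‖) = fun ω => √(∑ i, ‖y ω i‖ ^ 2) :=
    funext fun ω => PiLp.norm_eq_of_L2 _
  rw [h]
  exact (Finset.measurable_sum _ fun i _ => (hy i).norm.pow_const 2).sqrt

/-- The deviations after averaging and the gradient step, before the quantization noise is
added. -/
def drift {N d : ℕ} (A : Matrix (Fin N) (Fin N) ℝ) (f : Fin N → EuclideanSpace ℝ (Fin d) → ℝ)
    (ε η : ℝ) (x : Fin N → EuclideanSpace ℝ (Fin d)) : AgentSpace N d :=
  (1 - ε) • deviation x + ε • mix (A - averagingMatrix N) (deviation x)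
    - η • deviation fun i => gradient (f i) (x i)

section Run

variable {N d : ℕ} {Ω : Type*} {mΩ : MeasurableSpace Ω} {μ : Measure Ω}
  {ℱ : Filtration ℕ mΩ} {A : Matrix (Fin N) (Fin N) ℝ} {s G : ℝ}
  {f : Fin N → EuclideanSpace ℝ (Fin d) → ℝ} {ℓ : ℝ} {ε η : ℕ → ℝ}
  {x₀ : Fin N → EuclideanSpace ℝ (Fin d)} {x q : ℕ → Ω → Fin N → EuclideanSpace ℝ (Fin d)}

theorem norm_drift_le (hA : IsWeightMatrix A s) (hG : 0 ≤ G) (hg : ∀ i θ, ‖gradient (f i) θ‖ ≤ G)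
    {e h : ℝ} (he : 0 ≤ e) (hh : 0 ≤ h) (y : Fin N → EuclideanSpace ℝ (Fin d)) :
    ‖drift A f e h y‖ ≤ (|1 - e| + e * s) * ‖deviation y‖ + h * (√N * (2 * G)) := by
  unfold drift
  refine (norm_sub_le _ _).trans ?_
  have h1 := norm_add_le ((1 - e) • deviation y)
    (e • mix (A - averagingMatrix N) (deviation y))
  have h2 : ‖mix (A - averagingMatrix N) (deviation y)‖ ≤ s * ‖deviation y‖ := hA.norm_mix_le _
  have h3 : ‖deviation fun i => gradient (f i) (y i)‖ ≤ √N * (2 * G) :=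
    norm_deviation_le hG fun i => hg i _
  rw [norm_smul, norm_smul, Real.norm_eq_abs, Real.norm_of_nonneg he] at h1
  rw [norm_smul h, Real.norm_of_nonneg hh]
  nlinarith [mul_le_mul_of_nonneg_left h2 he, mul_le_mul_of_nonneg_left h3 hh]

theorem IsRun.deviation_succ (hA : IsWeightMatrix A s) (hx : IsRun μ ℱ A f ℓ ε η x₀ x q)
    (k : ℕ) (ω : Ω) :
    deviation (x (k + 1) ω) = drift A f (ε k) (η k) (x k ω) +
      ε k • mix (A - averagingMatrix N) fun i => q k ω i - x k ω i :=
  hA.deviation_update _ _ _ _ _ _ (hx.update k ω)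

theorem IsRun.measurable (hx : IsRun μ ℱ A f ℓ ε η x₀ x q)
    (hf : ∀ i, Continuous (gradient (f i))) (k : ℕ) (i : Fin N) :
    Measurable[ℱ k] fun ω => x k ω i := by
  induction k generalizing i with
  | zero => simp only [hx.start]; exact measurable_const
  | succ k ih =>
    have hxk : ∀ i, Measurable[ℱ (k + 1)] fun ω => x k ω i := fun i =>
      (ih i).mono (ℱ.mono k.le_succ) le_rfl
    have hqk : ∀ i, Measurable[ℱ (k + 1)] fun ω => q k ω i := fun i =>
      measurable_euclidean (hx.adapted k i)
    have hgk : Measurable[ℱ (k + 1)] fun ω => gradient (f i) (x k ω i) :=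
      (hf i).measurable.comp (hxk i)
    simp only [hx.update]
    fun_prop

variable [IsProbabilityMeasure μ]

theorem IsRun.rounding (hx : IsRun μ ℱ A f ℓ ε η x₀ x q) (hℓ : 0 < ℓ)
    (hf : ∀ i, Continuous (gradient (f i))) (k : ℕ) (i : Fin N) (c : Fin d) :
    (∀ᵐ ω ∂μ, |q k ω i c - x k ω i c| ≤ ℓ) ∧
      ∀ (h : Ω → ℝ) (b : ℝ), StronglyMeasurable[ℱ k] h → (∀ᵐ ω ∂μ, |h ω| ≤ b) →
        Integrable (fun ω => h ω * (q k ω i c - x k ω i c)) μ ∧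
          ∫ ω, h ω * (q k ω i c - x k ω i c) ∂μ = 0 := by
  have hxm : Measurable fun ω => x k ω i := (hx.measurable hf k i).mono (ℱ.le k) le_rfl
  have hxc : Measurable fun ω => x k ω i c := by fun_prop
  exact unbiased_rounding (ℱ.le k) hℓ ((measurable_quantLower ℓ k).comp hxc)
    ((hx.adapted k i c).mono (ℱ.le _) le_rfl) (fun ω => sub_quantLower hℓ.ne' k _)
    (fun ω => quantProb_mem ℓ k _) (hx.prob_upper k i c) (hx.prob_lower k i c)

theorem IsRun.norm_noise_le (hA : IsWeightMatrix A s) (hs : s ≤ 1)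
    (hx : IsRun μ ℱ A f ℓ ε η x₀ x q) (hℓ : 0 < ℓ) (hf : ∀ i, Continuous (gradient (f i))) :
    ∀ᵐ ω ∂μ, ∀ k,
      ‖mix (A - averagingMatrix N) fun i => q k ω i - x k ω i‖ ≤ √N * (√d * ℓ) := by
  have h : ∀ᵐ ω ∂μ, ∀ k i c, |q k ω i c - x k ω i c| ≤ ℓ := by
    simp only [ae_all_iff]
    exact fun k i c => (hx.rounding hℓ hf k i c).1
  filter_upwards [h] with ω hω k
  refine (hA.norm_mix_le _).trans ((mul_le_of_le_one_left (norm_nonneg _) hs).trans ?_)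
  refine norm_toLp_le (by positivity) fun i => ?_
  rw [EuclideanSpace.norm_eq]
  apply Real.sqrt_le_iff.2 ⟨by positivity, ?_⟩
  rw [mul_pow, Real.sq_sqrt (Nat.cast_nonneg d)]
  calc ∑ c, ‖(q k ω i - x k ω i) c‖ ^ 2 ≤ ∑ _c : Fin d, ℓ ^ 2 := by
        gcongr with c
        exact hω k i c
    _ = d * ℓ ^ 2 := by simp

/-- An almost sure bound for the `k`-th consensus error, used for integrability and on a finite
initial stretch, where the stepsize may exceed `1`. Here `b` bounds the initial error, `g`
the gradient term and `Z` the noise. -/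
def errorBound (c₁ b g Z : ℝ) : ℕ → ℝ
  | 0 => b
  | k + 1 => (1 + 2 * c₁) * errorBound c₁ b g Z k + c₁ * g + c₁ * Z

theorem IsRun.norm_deviation_le_errorBound (hA : IsWeightMatrix A s) (hs : s ≤ 1)
    (hx : IsRun μ ℱ A f ℓ ε η x₀ x q) (hℓ : 0 < ℓ) (hf : ∀ i, Continuous (gradient (f i)))
    (hG : 0 ≤ G) (hg : ∀ i θ, ‖gradient (f i) θ‖ ≤ G) {c₁ b : ℝ}
    (hε : ∀ k, ε k ∈ Set.Icc 0 c₁) (hη : ∀ k, η k ∈ Set.Icc 0 c₁) (hb : consensusError x₀ ≤ b) :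
    ∀ᵐ ω ∂μ, ∀ k,
      ‖deviation (x k ω)‖ ≤ errorBound c₁ b (√N * (2 * G)) (√N * (√d * ℓ)) k := by
  filter_upwards [hx.norm_noise_le hA hs hℓ hf] with ω hω k
  induction k with
  | zero => rw [hx.start, ← consensusError_eq_norm]; exact hb
  | succ k ih =>
    obtain ⟨e0, e1⟩ := hε k
    obtain ⟨h0, h1⟩ := hη k
    rw [hx.deviation_succ hA, errorBound]
    refine (norm_add_le _ _).trans ?_
    have hd := norm_drift_le hA hG hg e0 h0 (x k ω)
    rw [norm_smul, Real.norm_of_nonneg e0]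
    have hc : |1 - ε k| + ε k * s ≤ 1 + 2 * c₁ := by
      have : |1 - ε k| ≤ 1 + ε k := by rw [abs_le]; constructor <;> linarith
      nlinarith
    have t1 : (|1 - ε k| + ε k * s) * ‖deviation (x k ω)‖ ≤
        (1 + 2 * c₁) * errorBound c₁ b (√N * (2 * G)) (√N * (√d * ℓ)) k :=
      mul_le_mul hc ih (norm_nonneg _) (by linarith)
    have t2 : η k * (√N * (2 * G)) ≤ c₁ * (√N * (2 * G)) := by gcongr
    have t3 := mul_le_mul e1 (hω k) (norm_nonneg _) (e0.trans e1)
    linarith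

omit [IsProbabilityMeasure μ] in
theorem IsRun.measurable_drift (hx : IsRun μ ℱ A f ℓ ε η x₀ x q)
    (hf : ∀ i, Continuous (gradient (f i))) (k : ℕ) (i : Fin N) :
    Measurable[ℱ k] fun ω => drift A f (ε k) (η k) (x k ω) i := by
  have hxk := hx.measurable hf k
  have h1 : ∀ i, Measurable[ℱ k] fun ω => deviation (x k ω) i := measurable_deviation hxk
  have h2 : Measurable[ℱ k] fun ω => mix (A - averagingMatrix N) (deviation (x k ω)) i :=
    measurable_mix _ h1 i
  have h3 : Measurable[ℱ k] fun ω => deviation (fun i => gradient (f i) (x k ω i)) i :=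
    measurable_deviation (y := fun ω i => gradient (f i) (x k ω i))
      (fun i => (hf i).measurable.comp (hxk i)) i
  exact (((h1 i).const_smul _).add (h2.const_smul _)).sub (h3.const_smul _)

/-- The noise is conditionally centred, so a bounded weight times its component along a bounded
`u` known at time `k` integrates to zero. -/
theorem IsRun.integral_cross (hx : IsRun μ ℱ A f ℓ ε η x₀ x q) (hℓ : 0 < ℓ)
    (hf : ∀ i, Continuous (gradient (f i))) (k : ℕ) (B : Matrix (Fin N) (Fin N) ℝ)
    {u : Ω → AgentSpace N d} (hum : ∀ i, Measurable[ℱ k] fun ω => u ω i) {b : ℝ}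
    (hb : ∀ᵐ ω ∂μ, ‖u ω‖ ≤ b) :
    Integrable (fun ω => (‖u ω‖ ^ 2) ^ 3 * inner ℝ (u ω) (mix B fun i => q k ω i - x k ω i)) μ ∧
      ∫ ω, (‖u ω‖ ^ 2) ^ 3 * inner ℝ (u ω) (mix B fun i => q k ω i - x k ω i) ∂μ = 0 := by
  have hun : Measurable[ℱ k] fun ω => ‖u ω‖ := measurable_norm_agentSpace hum
  set h : Fin N → Fin d → Ω → ℝ := fun j c ω => (‖u ω‖ ^ 2) ^ 3 * ∑ i, B i j * u ω i c with hh
  have hhm : ∀ j c, StronglyMeasurable[ℱ k] (h j c) := by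
    intro j c
    apply Measurable.stronglyMeasurable
    refine ((hun.pow_const 2).pow_const 3).mul (Finset.measurable_sum _ fun i _ => ?_)
    refine Measurable.const_mul ?_ _
    exact (EuclideanSpace.proj (𝕜 := ℝ) c).continuous.measurable.comp (hum i)
  have hhb : ∀ j c, ∀ᵐ ω ∂μ, |h j c ω| ≤ (b ^ 2) ^ 3 * ∑ i, |B i j| * b := by
    intro j c
    filter_upwards [hb] with ω hω
    rw [hh, abs_mul, abs_of_nonneg (by positivity)]
    have h1 : |∑ i, B i j * u ω i c| ≤ ∑ i, |B i j| * b := by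
      refine (Finset.abs_sum_le_sum_abs _ _).trans (Finset.sum_le_sum fun i _ => ?_)
      rw [abs_mul]
      gcongr
      calc |u ω i c| ≤ ‖u ω i‖ := PiLp.norm_apply_le (u ω i) c
        _ ≤ ‖u ω‖ := PiLp.norm_apply_le (u ω) i
        _ ≤ b := hω
    gcongr
  have heq : (fun ω => (‖u ω‖ ^ 2) ^ 3 * inner ℝ (u ω) (mix B fun i => q k ω i - x k ω i)) =
      fun ω => ∑ j, ∑ c, h j c ω * (q k ω j c - x k ω j c) := by
    funext ω
    rw [inner_mix, Finset.mul_sum]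
    refine Finset.sum_congr rfl fun j _ => ?_
    rw [Finset.mul_sum]
    refine Finset.sum_congr rfl fun c _ => ?_
    rw [hh, PiLp.sub_apply]
    ring
  have hr := fun j c => (hx.rounding hℓ hf k j c).2 (h j c) _ (hhm j c) (hhb j c)
  rw [heq]
  refine ⟨integrable_finsetSum _ fun j _ => integrable_finsetSum _ fun c _ => (hr j c).1, ?_⟩
  rw [integral_finsetSum _ fun j _ => integrable_finsetSum _ fun c _ => (hr j c).1]
  refine Finset.sum_eq_zero fun j _ => ?_
  rw [integral_finsetSum _ fun c _ => (hr j c).1]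
  exact Finset.sum_eq_zero fun c _ => (hr j c).2

theorem IsRun.integrable_pow_eight (hx : IsRun μ ℱ A f ℓ ε η x₀ x q)
    (hf : ∀ i, Continuous (gradient (f i))) (k : ℕ) {b : ℝ}
    (hb : ∀ᵐ ω ∂μ, ‖deviation (x k ω)‖ ≤ b) :
    Integrable (fun ω => ‖deviation (x k ω)‖ ^ 8) μ := by
  have hm : Measurable[ℱ k] fun ω => ‖deviation (x k ω)‖ :=
    measurable_norm_agentSpace (measurable_deviation (hx.measurable hf k))
  refine Integrable.of_bound
    ((hm.mono (ℱ.le k) le_rfl).pow_const 8).aestronglyMeasurable (b ^ 8) ?_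
  filter_upwards [hb] with ω hω
  rw [Real.norm_of_nonneg (by positivity)]
  gcongr

/-- The eighth moment of the consensus error contracts at rate `(1 - s) ε / 2`, up to an error of
order `ε⁵`. The constant depends only on the listed parameters. -/
theorem exists_moment_recursion (N d : ℕ) (ℓ G s H : ℝ) (hℓ : 0 < ℓ) (hG : 0 ≤ G) (hs : s < 1) :
    ∃ K, 0 ≤ K ∧ ∀ {Ω : Type*} {mΩ : MeasurableSpace Ω} {μ : Measure Ω} [IsProbabilityMeasure μ]
      {ℱ : Filtration ℕ mΩ} {A : Matrix (Fin N) (Fin N) ℝ}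
      {f : Fin N → EuclideanSpace ℝ (Fin d) → ℝ} {ε η : ℕ → ℝ}
      {x₀ : Fin N → EuclideanSpace ℝ (Fin d)} {x q : ℕ → Ω → Fin N → EuclideanSpace ℝ (Fin d)}
      {M : ℕ → ℝ}, IsWeightMatrix A s → IsRun μ ℱ A f ℓ ε η x₀ x q →
      (∀ i, Continuous (gradient (f i))) → (∀ i θ, ‖gradient (f i) θ‖ ≤ G) →
      (∀ᵐ ω ∂μ, ∀ k, ‖deviation (x k ω)‖ ≤ M k) →
      ∀ k, 0 < ε k → 0 ≤ η k → η k ^ 2 ≤ H * ε k ^ 3 → ε k ≤ 1 →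
      ∫ ω, ‖deviation (x (k + 1) ω)‖ ^ 8 ∂μ ≤
        (1 - (1 - s) / 2 * ε k) * ∫ ω, ‖deviation (x k ω)‖ ^ 8 ∂μ + K * ε k ^ 5 := by
  set g := √N * (2 * G)
  set Z := √N * (√d * ℓ)
  have hg0 : 0 ≤ g := by positivity
  have hZ0 : 0 ≤ Z := by positivity
  obtain ⟨K, hK, hstep⟩ := exists_pow_eight_recursion (1 - s) g Z H (by linarith) hg0
  refine ⟨K, hK, ?_⟩
  intro Ω mΩ μ _ ℱ A f ε η x₀ x q M hA hx hf hg hM k hε hη hηε hε1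
  have hs0 := hA.nonneg
  set u : Ω → AgentSpace N d := fun ω => drift A f (ε k) (η k) (x k ω) with hu
  set z : Ω → AgentSpace N d := fun ω =>
    mix (A - averagingMatrix N) fun i => q k ω i - x k ω i with hz
  have hud : ∀ ω, ‖u ω‖ ≤ (1 - (1 - s) * ε k) * ‖deviation (x k ω)‖ + η k * g := by
    intro ω
    have h := norm_drift_le hA hG hg hε.le hη (x k ω)
    rw [abs_of_nonneg (sub_nonneg.2 hε1)] at h
    have e : 1 - ε k + ε k * s = 1 - (1 - s) * ε k := by ring
    rwa [e] at h
  have hκε : (1 - s) * ε k ≤ 1 := by nlinarith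
  have hub : ∀ᵐ ω ∂μ, ‖u ω‖ ≤ M k + η k * g := by
    filter_upwards [hM] with ω hω
    have h1 := hω k
    have : (1 - (1 - s) * ε k) * ‖deviation (x k ω)‖ ≤ 1 * ‖deviation (x k ω)‖ := by
      gcongr
      nlinarith
    linarith [hud ω]
  obtain ⟨hci, hc0⟩ := hx.integral_cross hℓ hf k (A - averagingMatrix N)
    (hx.measurable_drift hf k) hub
  have hvi := hx.integrable_pow_eight hf k (hM.mono fun ω h => h k)
  have hvi' := hx.integrable_pow_eight hf (k + 1) (hM.mono fun ω h => h (k + 1))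
  have hpt : ∀ᵐ ω ∂μ, ‖deviation (x (k + 1) ω)‖ ^ 8 ≤
      (1 - (1 - s) / 2 * ε k) * ‖deviation (x k ω)‖ ^ 8 + K * ε k ^ 5 +
        8 * ε k * ((‖u ω‖ ^ 2) ^ 3 * inner ℝ (u ω) (z ω)) := by
    filter_upwards [hx.norm_noise_le hA hs.le hℓ hf] with ω hω
    have hzω : ‖z ω‖ ≤ Z := hω k
    have hi : |2 * ε k * inner ℝ (u ω) (z ω)| ≤ 2 * ‖u ω‖ * (ε k * Z) := by
      rw [abs_mul, abs_of_nonneg (by positivity)]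
      have := (abs_real_inner_le_norm (u ω) (z ω)).trans
        (mul_le_mul_of_nonneg_left hzω (norm_nonneg _))
      calc 2 * ε k * |inner ℝ (u ω) (z ω)| ≤ 2 * ε k * (‖u ω‖ * Z) := by gcongr
        _ = _ := by ring
    have h := hstep (ε k) (η k) ‖deviation (x k ω)‖ ‖u ω‖ (2 * ε k * inner ℝ (u ω) (z ω))
      ((ε k * ‖z ω‖) ^ 2) hε hη hηε hκε (norm_nonneg _) (norm_nonneg _) (hud ω) hi
      (sq_nonneg _) (by gcongr)
    have hsq : ‖deviation (x (k + 1) ω)‖ ^ 2 =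
        ‖u ω‖ ^ 2 + 2 * ε k * inner ℝ (u ω) (z ω) + (ε k * ‖z ω‖) ^ 2 := by
      rw [hx.deviation_succ hA, norm_add_sq_real, inner_smul_right, norm_smul,
        Real.norm_of_nonneg hε.le]
      ring
    have h8 : ‖deviation (x (k + 1) ω)‖ ^ 8 = (‖deviation (x (k + 1) ω)‖ ^ 2) ^ 4 := by ring
    rw [h8, hsq]
    exact h.trans_eq (by ring)
  have hi1 : Integrable (fun ω => (1 - (1 - s) / 2 * ε k) * ‖deviation (x k ω)‖ ^ 8) μ :=
    hvi.const_mul _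
  have hi2 : Integrable (fun ω => (1 - (1 - s) / 2 * ε k) * ‖deviation (x k ω)‖ ^ 8 +
      K * ε k ^ 5) μ := hi1.add (integrable_const _)
  have hi3 : Integrable (fun ω => 8 * ε k * ((‖u ω‖ ^ 2) ^ 3 * inner ℝ (u ω) (z ω))) μ :=
    hci.const_mul _
  refine (integral_mono_ae hvi' (hi2.add hi3) hpt).trans_eq ?_
  have hc0' : ∫ ω, 8 * ε k * ((‖u ω‖ ^ 2) ^ 3 * inner ℝ (u ω) (z ω)) ∂μ = 0 := by
    rw [integral_const_mul]
    exact mul_eq_zero_of_right _ hc0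
  rw [integral_add' hi2 hi3, integral_add hi1 (integrable_const _), integral_const_mul, hc0']
  simp

end Run

/-! ### From moments to almost sure bounds -/

/-- Markov's inequality for the fourth power of `V`, against the threshold `C k ^ (-α / 3)`. -/
theorem measure_lt_le_of_moment {Ω : Type*} {mΩ : MeasurableSpace Ω} {μ : Measure Ω}
    [IsProbabilityMeasure μ] {v : Ω → ℝ} {α C P : ℝ} (hC : 0 < C) {k : ℕ} (hk : 1 ≤ k)
    (hint : Integrable (fun ω => v ω ^ 8) μ)
    (hm : ∫ ω, v ω ^ 8 ∂μ ≤ P * (k : ℝ) ^ (-4 * α)) :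
    μ {ω | ¬ v ω ^ 2 ≤ C * (1 / (k : ℝ)) ^ (α / 3)} ≤
      ENNReal.ofReal (P / C ^ 4 * (k : ℝ) ^ (-(8 * α / 3))) := by
  have hk0 : (0 : ℝ) < k := by exact_mod_cast hk
  set T := C * (1 / (k : ℝ)) ^ (α / 3) with hT
  have hT0 : 0 < T := by positivity
  have hT4 : T ^ 4 = C ^ 4 * (k : ℝ) ^ (-(4 * α / 3)) := by
    rw [hT, mul_pow, one_div, Real.inv_rpow hk0.le, ← Real.rpow_neg hk0.le, ← Real.rpow_natCast
      ((k : ℝ) ^ _), ← Real.rpow_mul hk0.le]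
    congr 2; push_cast; ring
  have hM := mul_meas_ge_le_integral_of_nonneg
    (ae_of_all _ fun ω => by positivity : 0 ≤ᵐ[μ] fun ω => v ω ^ 8) hint (T ^ 4)
  have hsub : {ω | ¬ v ω ^ 2 ≤ T} ⊆ {ω | T ^ 4 ≤ v ω ^ 8} := by
    intro ω hω
    have h : T ≤ v ω ^ 2 := (not_le.1 hω).le
    calc T ^ 4 ≤ (v ω ^ 2) ^ 4 := by gcongr
      _ = v ω ^ 8 := by ring
  refine (measure_mono hsub).trans ?_
  rw [← ofReal_measureReal]
  apply ENNReal.ofReal_le_ofReal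
  have h4 : 0 < T ^ 4 := by positivity
  rw [← mul_le_mul_iff_right₀ h4]
  refine (hM.trans hm).trans_eq ?_
  have : (k : ℝ) ^ (-4 * α) = (k : ℝ) ^ (-(4 * α / 3)) * (k : ℝ) ^ (-(8 * α / 3)) := by
    rw [← Real.rpow_add hk0]; congr 1; ring
  rw [hT4, this]
  field_simp

/-- A union bound over `k ≥ t₀`, and the Borel–Cantelli lemma, for events of probability
`≲ k ^ (-8 α / 3)`. The factor `k ^ (-2 α / 3)` is at most its value at `t₀`, and the remaining
`k ^ (-2 α)` is summable. -/
theorem union_bound_and_borelCantelli {Ω : Type*} {mΩ : MeasurableSpace Ω} {μ : Measure Ω}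
    [IsProbabilityMeasure μ] {S : ℕ → Set Ω} {α B p : ℝ} (hα : 1 / 2 < α) (hB : 0 ≤ B)
    {t₀ : ℕ} (ht₀ : 1 ≤ t₀)
    (hS : ∀ k : ℕ, 1 ≤ k → μ (S k)ᶜ ≤ ENNReal.ofReal (B * (k : ℝ) ^ (-(8 * α / 3))))
    (hp : B * (∑' k : ℕ, (k : ℝ) ^ (-(2 * α))) * (t₀ : ℝ) ^ (-(2 * α / 3)) ≤ p) :
    ENNReal.ofReal (1 - p) ≤ μ {ω | ∀ k : ℕ, t₀ ≤ k → ω ∈ S k} ∧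
      ∀ᵐ ω ∂μ, ∀ᶠ k in atTop, ω ∈ S k := by
  have ht : (0 : ℝ) < t₀ := by exact_mod_cast ht₀
  have hsum : Summable fun k : ℕ => (k : ℝ) ^ (-(2 * α)) :=
    Real.summable_nat_rpow.2 (by linarith)
  set F : ℕ → Set Ω := fun k => {ω | t₀ ≤ k ∧ ω ∉ S k} with hF
  set c := B * (t₀ : ℝ) ^ (-(2 * α / 3)) with hc
  have hc0 : 0 ≤ c := by positivity
  have hFk : ∀ k, μ (F k) ≤ ENNReal.ofReal (c * (k : ℝ) ^ (-(2 * α))) := by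
    intro k
    by_cases hk : t₀ ≤ k
    · have hk1 : 1 ≤ k := ht₀.trans hk
      have hk0 : (0 : ℝ) < k := by exact_mod_cast hk1
      have hsub : F k ⊆ (S k)ᶜ := fun ω h => h.2
      refine (measure_mono hsub).trans ((hS k hk1).trans (ENNReal.ofReal_le_ofReal ?_))
      have h1 : (k : ℝ) ^ (-(8 * α / 3)) = (k : ℝ) ^ (-(2 * α / 3)) * (k : ℝ) ^ (-(2 * α)) := by
        rw [← Real.rpow_add hk0]; congr 1; ring
      have h2 : (k : ℝ) ^ (-(2 * α / 3)) ≤ (t₀ : ℝ) ^ (-(2 * α / 3)) :=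
        Real.rpow_le_rpow_of_nonpos ht (by exact_mod_cast hk) (by linarith)
      rw [h1, hc, mul_assoc B]
      gcongr
    · have : F k = ∅ := Set.eq_empty_of_forall_notMem fun ω h => hk h.1
      rw [this]; simp
  have htsum : ∑' k : ℕ, ENNReal.ofReal (c * (k : ℝ) ^ (-(2 * α))) ≤ ENNReal.ofReal p := by
    rw [← ENNReal.ofReal_tsum_of_nonneg (fun k => by positivity) (hsum.mul_left c), tsum_mul_left]
    apply ENNReal.ofReal_le_ofReal
    refine le_trans (le_of_eq ?_) hp
    rw [hc]; ring
  have hFsum : ∑' k, μ (F k) ≤ ENNReal.ofReal p := (ENNReal.tsum_le_tsum hFk).trans htsum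
  constructor
  · have hcompl : {ω | ∀ k : ℕ, t₀ ≤ k → ω ∈ S k}ᶜ ⊆ ⋃ k, F k := by
      intro ω hω
      simp only [Set.mem_compl_iff, Set.mem_ofPred_eq, not_forall] at hω
      obtain ⟨k, hk, hk'⟩ := hω
      exact Set.mem_iUnion.2 ⟨k, hk, hk'⟩
    have h1 : μ {ω | ∀ k : ℕ, t₀ ≤ k → ω ∈ S k}ᶜ ≤ ENNReal.ofReal p :=
      (measure_mono hcompl).trans ((measure_iUnion_le _).trans hFsum)
    have h2 : (1 : ENNReal) ≤ μ {ω | ∀ k : ℕ, t₀ ≤ k → ω ∈ S k} +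
        μ {ω | ∀ k : ℕ, t₀ ≤ k → ω ∈ S k}ᶜ := by
      rw [← measure_univ (μ := μ), ← Set.union_compl_self {ω | ∀ k : ℕ, t₀ ≤ k → ω ∈ S k}]
      exact measure_union_le _ _
    have hp0 : 0 ≤ p := le_trans (by positivity) hp
    rw [ENNReal.ofReal_sub _ hp0, ENNReal.ofReal_one]
    exact tsub_le_iff_right.2 (h2.trans (by gcongr))
  · have hne : ∑' k, μ (F k) ≠ ⊤ := ne_top_of_le_ne_top ENNReal.ofReal_ne_top hFsum
    filter_upwards [ae_eventually_notMem hne] with ω hω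
    filter_upwards [hω, eventually_ge_atTop t₀] with k hk hkt
    by_contra hcon
    exact hk ⟨hkt, hcon⟩

end

theorem mainTheorem3
    (N d : ℕ) (hN : 2 ≤ N)
    (α β c₁ c₂ ℓ ε ρ G s R : ℝ)
    (hα : 0.6 < α) (hα' : α < 2 / 3) (hβ : 3 / 2 * α < β) (hβ' : β < 1)
    (hc₁ : 0 < c₁) (hc₂ : 0 < c₂) (hℓ : 0 < ℓ) (hε : 0 < ε) (hρ : 0 < ρ) (hG : 0 < G)
    (hs : s < 1) :
    ∃ C : ℝ, 0 < C ∧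
      ∀ (A : Matrix (Fin N) (Fin N) ℝ) (hA : IsWeightMatrix A s)
        (f : Fin N → EuclideanSpace ℝ (Fin d) → ℝ) (L r : Fin N → ℝ)
        (_ : ∀ i, IsSmoothObjective (f i) (L i) (r i))
        (_ : ρ = (1 / (N : ℝ)) * ∑ i, r i)
        (_ : ∀ i θ, ‖gradient (f i) θ‖ ≤ G)
        (x₀ : Fin N → EuclideanSpace ℝ (Fin d)) (_ : consensusError x₀ ≤ R)
        (fstar : ℝ) (_ : ∀ θ, fstar ≤ globalObjective f fun _ => θ)
        (_ : fstar ≤ globalObjective f x₀)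
        (γ : ℝ) (_ : 0 < γ)
        (p : ℝ) (_ : 0 < p) (_ : p < 1)
        (σ D Δ : ℝ) (_ : σ = secondEigenvalue A hA.symm hN)
        (_ : D = noiseConst N d (refStep c₁ c₂ α 0) σ G ℓ)
        (_ : Δ = globalObjective f x₀ - fstar)
        (t₀ : ℕ)
        (_ : max (threshold₁ α c₁ c₂ p σ D)
          (max (threshold₂ α β c₁ c₂ p ρ ε σ D Δ) (threshold₃ α β ρ ε γ ℓ σ D)) ≤ t₀)
        (t : ℕ → ℕ) (_ : t = holdTime c₁ c₂ α ρ ε t₀)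
        (I : ℕ) (_ : I = numHold α β c₁ c₂ ρ ε Δ t₀)
        (Ω : Type*) (mΩ : MeasurableSpace Ω) (μ : Measure Ω) (_ : IsProbabilityMeasure μ)
        (ℱ : Filtration ℕ mΩ)
        (x q : ℕ → Ω → Fin N → EuclideanSpace ℝ (Fin d))
        (_ : IsRun μ ℱ A f ℓ (stepsize c₁ c₂ α t I) (stepsize c₁ c₂ β t I) x₀ x q),
        ENNReal.ofReal (1 - p) ≤
            μ {ω | ∀ k : ℕ, t₀ ≤ k →
              consensusError (x k ω) ^ 2 ≤ C * (1 / (k : ℝ)) ^ (α / 3)} ∧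
          ∀ᵐ ω ∂μ, Tendsto (fun k => consensusError (x k ω)) atTop (𝓝 0) := by
  norm_num at hα
  have hα0 : 0 < α := by linarith
  have hα1 : α < 1 := by linarith
  have hβ0 : 0 < β := by linarith
  set H := (1 + (1 + c₂) ^ 3 / c₂ ^ 2) / c₁
  obtain ⟨K, hK, hrec⟩ := exists_moment_recursion N d ℓ G s H hℓ hG.le hs
  set M := errorBound c₁ R (√N * (2 * G)) (√N * (√d * ℓ))
  obtain ⟨P, hP, hmom⟩ := exists_rpow_bound_of_recursion α (c₁ / (1 + c₂))
    (c₁ / c₂ * (2 + (1 + c₂) / (c₁ * √(ρ * ε))) ^ α) ((1 - s) / 2) K hα0 hα1 (by positivity)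
    (by linarith) hK fun k => M k ^ 8
  set S := ∑' k : ℕ, (k : ℝ) ^ (-(2 * α))
  have hS0 : 0 ≤ S := tsum_nonneg fun k => by positivity
  set κ := c₁ ^ (2 / 3 : ℝ) * G ^ 2 / c₂ ^ (2 / 3 : ℝ) with hκ
  have hκ0 : 0 < κ := by positivity
  -- `C` is chosen so that `P / C ^ 4 * S ≤ κ`, where `p ≥ κ * t₀ ^ (-2 α / 3)`.
  refine ⟨1 + P * S / κ, by positivity, ?_⟩
  set C := 1 + P * S / κ with hC
  have hC0 : 0 < C := by positivity
  have hCκ : P / C ^ 4 * S ≤ κ := by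
    rw [div_mul_eq_mul_div, div_le_iff₀ (by positivity)]
    have h1 : (1 : ℝ) ≤ C := by
      have : 0 ≤ P * S / κ := by positivity
      linarith
    have h2 : C ≤ C ^ 4 := le_self_pow₀ h1 (by norm_num)
    have h3 : P * S / κ ≤ C ^ 4 := by linarith
    rw [div_le_iff₀ hκ0] at h3
    linarith
  intro A hA f L r hf _ hg x₀ hx₀ fstar _ _ γ _ p hp _ σ D Δ hσ hD _ t₀ ht₀ t ht I _ Ω mΩ μ _ ℱ x q
    hx
  subst ht hD
  have hσ' := hA.secondEigenvalue_mem hN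
  rw [← hσ] at hσ'
  obtain ⟨ht₀1, hpt⟩ := le_of_threshold₁_le hα0 hc₁ hc₂ hG hp
    ⟨by linarith [hσ'.1], hσ'.2.trans_lt hs⟩ ((le_max_left _ _).trans ht₀)
  have hfc : ∀ i, Continuous (gradient (f i)) := fun i => (hf i).differentiable_gradient.continuous
  have hMb := hx.norm_deviation_le_errorBound hA hs.le hℓ hfc hG.le hg
    (fun k => ⟨(refStep_pos hc₁ hc₂ _ _).le, refStep_le hc₁ hc₂ _ _⟩)
    (fun k => ⟨(refStep_pos hc₁ hc₂ _ _).le, refStep_le hc₁ hc₂ _ _⟩)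
    hx₀
  have hint : ∀ k, Integrable (fun ω => ‖deviation (x k ω)‖ ^ 8) μ := fun k =>
    hx.integrable_pow_eight hfc k (hMb.mono fun ω h => h k)
  have hbound := hmom (stepsize c₁ c₂ α (holdTime c₁ c₂ α ρ ε t₀) I)
    (fun k => ∫ ω, ‖deviation (x k ω)‖ ^ 8 ∂μ)
    (fun k hk => (stepsize_bounds hα1.le hα0 hc₁ hc₂ ht₀1 I hk).1)
    (fun k hk => (stepsize_bounds hα1.le hα0 hc₁ hc₂ ht₀1 I hk).2)
    (fun k => integral_nonneg fun ω => by positivity)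
    (fun k => by
      have h : ∫ ω, ‖deviation (x k ω)‖ ^ 8 ∂μ ≤ ∫ _, M k ^ 8 ∂μ :=
        integral_mono_ae (hint k) (integrable_const _) (hMb.mono fun ω h => by
          have := h k
          simp only
          gcongr)
      simpa using h)
    (fun k hk => hrec hA hx hfc hg hMb k (refStep_pos hc₁ hc₂ _ _)
      (refStep_pos hc₁ hc₂ _ _).le (refStep_sq_le hα0 hβ hc₁ hc₂ _) hk)
  obtain ⟨h1, h2⟩ := union_bound_and_borelCantelli (μ := μ) (α := α) (B := P / C ^ 4) (p := p)
    (S := fun k => {ω | consensusError (x k ω) ^ 2 ≤ C * (1 / (k : ℝ)) ^ (α / 3)})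
    (by linarith) (by positivity) ht₀1
    (fun k hk => by
      simp only [consensusError_eq_norm]
      exact measure_lt_le_of_moment hC0 hk (hint k) (hbound k hk))
    (le_trans (by gcongr) hpt)
  refine ⟨h1, ?_⟩
  have hlim : Tendsto (fun k : ℕ => √(C * (1 / (k : ℝ)) ^ (α / 3))) atTop (𝓝 0) := by
    have h := tendsto_one_div_atTop_nhds_zero_nat (𝕜 := ℝ)
    have h' := (h.rpow_const (p := α / 3) (Or.inr (by positivity))).const_mul C
    rw [Real.zero_rpow (by positivity), mul_zero] at h'
    simpa using h'.sqrt
  filter_upwards [h2] with ω hω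
  refine tendsto_of_tendsto_of_tendsto_of_le_of_le' tendsto_const_nhds hlim
    (Eventually.of_forall fun k => Real.sqrt_nonneg _) ?_
  filter_upwards [hω] with k hk
  exact Real.le_sqrt_of_sq_le hk
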